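/- Let $0<q<1$. **Algebras.** Let $\mathcal O(S^7_q)$ be the unital complex $*$-algebra generated by $x_1,\dots,x_4$ with relations $$x_1x_2=q\,x_2x_1,\quad x_1x_3=q\,x_3x_1,\quad x_1x_4=q^2x_4x_1,\quad x_2x_4=q\,x_4x_2,\quad x_3x_4=q\,x_4x_3,$$ $$x_2x_3=q^2x_3x_2+q^2(q-q^{-1})x_4x_1,$$ $$x_1^*x_1=x_1x_1^*,\quad x_1^*x_2=q\,x_2x_1^*,\quad x_1^*x_3=q\,x_3x_1^*,\quad x_1^*x_4=q^2x_4x_1^*,$$ $$x_2^*x_2=x_2x_2^*+(1-q^2)x_1x_1^*,\quad x_2^*x_3=q^2x_3x_2^*,\quad x_2^*x_4=q\,x_4x_2^*+q^2(q-q^{-1})x_3x_1^*,$$ $$x_3^*x_3=x_3x_3^*+(1-q^4)x_2x_2^*+(1-q^2)x_1x_1^*,\quad x_3^*x_4=q\,x_4x_3^*-q^4(q-q^{-1})x_2x_1^*,$$ $$\textstyle\sum_i x_ix_i^*=1,\qquad q^8x_1^*x_1+q^6x_2^*x_2+q^2x_3^*x_3+x_4^*x_4=1,$$ and their adjoints.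 Let $\mathcal O(SU_q(2))$ be the unital complex $*$-algebra generated by $\alpha,\gamma$ subject to the unitarity of $$T^{(1)}=\begin{pmatrix}\alpha&-q\gamma^*\\ \gamma&\alpha^*\end{pmatrix}.$$ Let $$u=(u^0,u^1)=\begin{pmatrix} qx_1&qx_2\\-q^2x_2^*&q^3x_1^*\\-x_3&x_4\\x_4^*&qx_3^*\end{pmatrix}.$$ The right coaction is the unital $*$-homomorphism $\delta_R:\mathcal O(S^7_q)\to\mathcal O(S^7_q)\otimes\mathcal O(SU_q(2))$ with $\delta_R(u_i^k)=\sum_{j=0,1}u_i^j\otimes (T^{(1)})_j^k$, and $\mathcal O(S^4_q)=\{b:\delta_R(b)=b\otimes1\}$. **The matrices.** Put $[n]=\frac{1-q^{2n}}{1-q^2}$ and $$\begin{bmatrix}n\\k\end{bmatrix}=\frac{\prod_{i=k+1}^n(1-q^{2i})}{\prod_{j=1}^{n-k}(1-q^{2j})}\qquad(0\le k\le n).$$ For column vectors $v,w$ let $v\bullet w$ be the column vector with entries $v_iw_j$. Let $T^{(n)}$ be the $(n+1)\times(n+1)$ matrix of the irreducible unitary corepresentation of $\mathcal O(SU_q(2))$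 of dimension $n+1$, with rows $k$ and columns $j$ numbered $0,\dots,n$ and entries $$(T^{(n)})_k^j=\begin{bmatrix}n\\k\end{bmatrix}^{\frac12}\begin{bmatrix}n\\j\end{bmatrix}^{-\frac12}\sum_{\substack{r+s=j\\0\le r\le k,\;0\le s\le n-k}}\begin{bmatrix}k\\r\end{bmatrix}\begin{bmatrix}n-k\\s\end{bmatrix}(-q)^sq^{s(k-r)}(\alpha^*)^r\gamma^{k-r}(\gamma^*)^s\alpha^{n-k-s}.$$ Let $U^{(0)}=(1)$, and for $n\ge1$ let $U^{(n)}$ be the $4^n\times(n+1)$ matrix over $\mathcal O(S^7_q)$ with columns $$U_{(n)}^k=[n]^{-\frac12}\Big(q^k[n-k]^{\frac12}\,u^0\bullet U_{(n-1)}^k+[k]^{\frac12}\,u^1\bullet U_{(n-1)}^{k-1}\Big),\qquad 0\le k\le n,$$ where columns of $U^{(n-1)}$ of index $-1$ and $n$ are $0$ (so $U^{(1)}=u$). For $n\ge0$ let $W^{(n)}$ be the $4^{n+2}\times(n+1)$ matrix with columns $$W_{(n)}^k=[n+2]^{-\frac12}\Big([k+1]^{\frac12}\,u^0\bullet U_{(n+1)}^{k+1}-q^{k+1}[n+1-k]^{\frac12}\,u^1\bullet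 U_{(n+1)}^{k}\Big),\qquad 0\le k\le n.$$ **The modules.** Let $V_n$ be the left $\mathcal O(SU_q(2))$-comodule with basis $e_0,\dots,e_n$ and coaction $\delta_L(e_i)=\sum_j(T^{(n)})_i^j\otimes e_j$. Let $\mathcal E_n=\mathcal O(S^7_q)\,\Box\,V_n$ be the cotensor product, that is, the right $\mathcal O(S^4_q)$-submodule of $\mathcal O(S^7_q)\otimes V_n$ on which $\delta_R\otimes\mathrm{id}$ and $\mathrm{id}\otimes\delta_L$ agree. **Proposition 5.7.** For every $n\ge0$: 1. $(W^{(n)})^*W^{(n)}=1_{n+1}$; 2. $(W^{(n)})^*U^{(n+2)}=0$; 3. $\delta_R\big((W^{(n)})_I^k\big)=\sum_{j=0}^n (W^{(n)})_I^j\otimes (T^{(n)})_j^k$ for all $I\in\{1,\dots,4\}^{n+2}$ and $0\le k\le n$; 4. $P^{(n)}=U^{(n)}(U^{(n)})^*$ and $Q^{(n)}=W^{(n)}(W^{(n)})^*$ have entries in $\mathcal O(S^4_q)$; $Q^{(n)}$ is a projection, $Q^{(n)}=(Q^{(n)})^*=(Q^{(n)})^2$; there is an isomorphism of right $\mathcal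 O(S^4_q)$-modules $Q^{(n)}\mathcal O(S^4_q)^{4^{n+2}}\cong\mathcal E_n$; and $P^{(n)}$ and $Q^{(n)}$ are von Neumann equivalent over $\mathcal O(S^4_q)$, that is, there is a $4^n\times4^{n+2}$ matrix $V$ with entries in $\mathcal O(S^4_q)$ such that $VV^*=P^{(n)}$ and $V^*V=Q^{(n)}$. -/

import Mathlib

set_option linter.unusedSimpArgs false

open scoped TensorProduct Matrix

noncomputable section

namespace QuantumSphere

/-! ### Free and finitely presented unital complex `*`-algebras -/

/-- The free unital complex `*`-algebra on a set `X` of generators: the free algebra on the symbols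
`(x, false)`, standing for `x`, and `(x, true)`, standing for `x^*`. -/
def FreeStar (X : Type) : Type := FreeAlgebra ℂ (X × Bool)

namespace FreeStar

variable {X : Type}

instance : Ring (FreeStar X) := inferInstanceAs (Ring (FreeAlgebra ℂ (X × Bool)))

instance : Algebra ℂ (FreeStar X) := inferInstanceAs (Algebra ℂ (FreeAlgebra ℂ (X × Bool)))

/-- The generator attached to `x ∈ X`. -/
def gen (x : X) : FreeStar X := FreeAlgebra.ι ℂ (x, false)

/-- The formal adjoint of the generator attached to `x ∈ X`. -/
def genStar (x : X) : FreeStar X := FreeAlgebra.ι ℂ (x, true)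

/-- The opposite of an algebra, with the complex conjugate scalar multiplication. -/
def ConjOp (A : Type) : Type := Aᵐᵒᵖ

instance (A : Type) [Ring A] : Ring (ConjOp A) := inferInstanceAs (Ring Aᵐᵒᵖ)

instance (A : Type) [Ring A] [Algebra ℂ A] : Algebra ℂ (ConjOp A) :=
  RingHom.toAlgebra' ((algebraMap ℂ Aᵐᵒᵖ).comp (starRingEnd ℂ))
    (fun c x => Algebra.commutes (A := Aᵐᵒᵖ) (starRingEnd ℂ c) x)

/-- The involution, as a homomorphism into the conjugate opposite algebra. -/
def starHom : FreeStar X →ₐ[ℂ] ConjOp (FreeStar X) :=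
  FreeAlgebra.lift ℂ fun p : X × Bool =>
    (MulOpposite.op (FreeAlgebra.ι ℂ (p.1, !p.2)) : (FreeAlgebra ℂ (X × Bool))ᵐᵒᵖ)

/-- The underlying map of the involution: conjugate linear, antimultiplicative, exchanging `x` and
`x^*`. -/
def starFun (a : FreeStar X) : FreeStar X := MulOpposite.unop (α := FreeStar X) (starHom a)

theorem starFun_add (a b : FreeStar X) : starFun (a + b) = starFun a + starFun b := by
  unfold starFun; rw [map_add]; rfl

theorem starFun_mul (a b : FreeStar X) : starFun (a * b) = starFun b * starFun a := by
  unfold starFun; rw [map_mul]; rfl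

theorem starFun_algebraMap (c : ℂ) :
    starFun (algebraMap ℂ (FreeStar X) c) = algebraMap ℂ (FreeStar X) (starRingEnd ℂ c) := by
  unfold starFun; rw [AlgHom.commutes]; rfl

theorem starFun_ι (p : X × Bool) :
    starFun (FreeAlgebra.ι ℂ p : FreeStar X) = (FreeAlgebra.ι ℂ (p.1, !p.2) : FreeStar X) := by
  unfold starFun starHom
  exact congrArg MulOpposite.unop (FreeAlgebra.lift_ι_apply (R := ℂ) (A := ConjOp (FreeStar X)) _ p)

theorem induction {C : FreeStar X → Prop} (h0 : ∀ c, C (algebraMap ℂ _ c))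
    (h1 : ∀ p : X × Bool, C (FreeAlgebra.ι ℂ p : FreeAlgebra ℂ (X × Bool)))
    (h2 : ∀ a b, C a → C b → C (a * b)) (h3 : ∀ a b, C a → C b → C (a + b)) (a : FreeStar X) :
    C a :=
  FreeAlgebra.induction ℂ (X × Bool) (motive := C) h0 h1 h2 h3 a

instance : StarRing (FreeStar X) where
  star := starFun
  star_involutive a := by
    induction a using induction with
    | h0 c => rw [starFun_algebraMap, starFun_algebraMap, Complex.conj_conj]
    | h1 p => rw [starFun_ι, starFun_ι, Bool.not_not]
    | h2 a b ha hb => rw [starFun_mul, starFun_mul, ha, hb]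
    | h3 a b ha hb => rw [starFun_add, starFun_add, ha, hb]
  star_mul := starFun_mul
  star_add := starFun_add

theorem star_algebraMap' (c : ℂ) :
    star (algebraMap ℂ (FreeStar X) c) = algebraMap ℂ (FreeStar X) (star c) :=
  starFun_algebraMap c

theorem star_gen (x : X) : star (gen x) = genStar x := starFun_ι (x, false)

theorem star_genStar (x : X) : star (genStar x) = gen x := starFun_ι (x, true)

instance : StarModule ℂ (FreeStar X) where
  star_smul c a := by
    rw [Algebra.smul_def, star_mul, star_algebraMap', Algebra.smul_def, Algebra.commutes]

section Lift

variable {A : Type} [Ring A] [Algebra ℂ A] [StarRing A]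

/-- The algebra homomorphism sending the generators to prescribed elements, and their formal
adjoints to the adjoints of these elements. -/
def liftHom (f : X → A) : FreeStar X →ₐ[ℂ] A :=
  FreeAlgebra.lift ℂ fun p : X × Bool => if p.2 then star (f p.1) else f p.1

theorem liftHom_ι (f : X → A) (p : X × Bool) :
    liftHom f (FreeAlgebra.ι ℂ p : FreeAlgebra ℂ (X × Bool)) =
      if p.2 then star (f p.1) else f p.1 :=
  FreeAlgebra.lift_ι_apply (R := ℂ) _ p

theorem liftHom_gen (f : X → A) (x : X) : liftHom f (gen x) = f x := by
  exact (liftHom_ι f (x, false)).trans (by simp)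

theorem liftHom_star [StarModule ℂ A] (f : X → A) (a : FreeStar X) : liftHom f (star a) = star (liftHom f a) := by
  induction a using induction with
  | h0 c => rw [star_algebraMap', AlgHom.commutes, AlgHom.commutes, algebraMap_star_comm]
  | h1 p =>
    refine (congrArg (liftHom f) (starFun_ι p)).trans ?_
    rw [liftHom_ι, liftHom_ι]
    rcases p with ⟨x, _ | _⟩ <;> simp
  | h2 a b ha hb => rw [star_mul, map_mul, map_mul, star_mul, ha, hb]
  | h3 a b ha hb => rw [star_add, map_add, map_add, star_add, ha, hb]

end Lift

end FreeStar

/-- The relations `R` together with their adjoints. -/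
inductive StarClosure {X : Type} (R : FreeStar X → FreeStar X → Prop) :
    FreeStar X → FreeStar X → Prop
  | of {a b : FreeStar X} (h : R a b) : StarClosure R a b
  | adj {a b : FreeStar X} (h : R a b) : StarClosure R (star a) (star b)

theorem StarClosure.star_mem {X : Type} (R : FreeStar X → FreeStar X → Prop) (a b : FreeStar X)
    (h : StarClosure R a b) : StarClosure R (star a) (star b) := by
  cases h with
  | of h => exact .adj h
  | adj h => rw [star_star, star_star]; exact .of h

/-- The unital complex `*`-algebra with generators `X` and relations `a = b` for `R a b`. -/
def Presented {X : Type} (R : FreeStar X → FreeStar X → Prop) : Type :=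
  RingQuot (StarClosure R)

namespace Presented

variable {X : Type} {R : FreeStar X → FreeStar X → Prop}

instance : Ring (Presented R) := inferInstanceAs (Ring (RingQuot (StarClosure R)))

instance : Algebra ℂ (Presented R) := inferInstanceAs (Algebra ℂ (RingQuot (StarClosure R)))

instance : StarRing (Presented R) := RingQuot.starRing (StarClosure R) (StarClosure.star_mem R)

/-- The quotient map. -/
def mk : FreeStar X →ₐ[ℂ] Presented R := RingQuot.mkAlgHom ℂ (StarClosure R)

theorem mk_surjective : Function.Surjective (mk : FreeStar X →ₐ[ℂ] Presented R) :=
  RingQuot.mkAlgHom_surjective ℂ (StarClosure R)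

theorem mk_star (a : FreeStar X) : (mk (star a) : Presented R) = star (mk a) := by
  have h : ∀ b : FreeStar X, mk b = RingQuot.mkRingHom (StarClosure R) b := fun b =>
    congrArg (fun g : FreeStar X →+* RingQuot (StarClosure R) => g b)
      (RingQuot.mkAlgHom_coe ℂ (StarClosure R))
  have h' : RingQuot.mkRingHom (StarClosure R) (star a) =
      (RingQuot.starRing (StarClosure R) (StarClosure.star_mem R)).star
        (RingQuot.mkRingHom (StarClosure R) a) := by
    simp only [RingQuot.mkRingHom_def]
    rfl
  exact (h _).trans (h'.trans (congrArg _ (h a).symm))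

theorem mk_eq {a b : FreeStar X} (h : R a b) : (mk a : Presented R) = mk b :=
  RingQuot.mkAlgHom_rel ℂ (StarClosure.of h)

instance : StarModule ℂ (Presented R) where
  star_smul c a := by
    obtain ⟨a, rfl⟩ := mk_surjective a
    rw [← map_smul, ← mk_star, star_smul, map_smul, mk_star]

variable {A : Type} [Ring A] [Algebra ℂ A] [StarRing A] [StarModule ℂ A]

/-- The universal property of a presented `*`-algebra, as an algebra homomorphism. -/
def liftAlgHom (f : X → A)
    (hf : ∀ a b, R a b → FreeStar.liftHom f a = FreeStar.liftHom f b) : Presented R →ₐ[ℂ] A :=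
  RingQuot.liftAlgHom ℂ (s := StarClosure R) ⟨FreeStar.liftHom f, fun a b h => by
    cases h with
    | of h => exact hf _ _ h
    | adj h => rw [FreeStar.liftHom_star, FreeStar.liftHom_star, hf _ _ h]⟩

theorem liftAlgHom_mk (f : X → A)
    (hf : ∀ a b, R a b → FreeStar.liftHom f a = FreeStar.liftHom f b) (a : FreeStar X) :
    liftAlgHom f hf (mk a) = FreeStar.liftHom f a :=
  RingQuot.liftAlgHom_mkAlgHom_apply ℂ _ _ a

/-- The universal property of a presented `*`-algebra. -/
def lift (f : X → A)
    (hf : ∀ a b, R a b → FreeStar.liftHom f a = FreeStar.liftHom f b) : Presented R →⋆ₐ[ℂ] A :=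
  { liftAlgHom f hf with
    map_star' := fun a => by
      change liftAlgHom f hf (star a) = star (liftAlgHom f hf a)
      obtain ⟨a, rfl⟩ := mk_surjective a
      rw [← mk_star, liftAlgHom_mk, liftAlgHom_mk, FreeStar.liftHom_star] }

theorem lift_mk_gen (f : X → A)
    (hf : ∀ a b, R a b → FreeStar.liftHom f a = FreeStar.liftHom f b) (x : X) :
    lift f hf (mk (FreeStar.gen x)) = f x :=
  (liftAlgHom_mk f hf _).trans (FreeStar.liftHom_gen f x)

end Presented

/-- The deformation parameter, as a complex scalar. -/
def qc (q : Set.Ioo (0 : ℝ) 1) : ℂ := ((q : ℝ) : ℂ)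

/-! ### The quantum group `SU_q(2)` -/

/-- The two generators `α` and `γ` of `O(SU_q(2))`. -/
inductive SUGen : Type
  | α
  | γ

/-- The matrix `[α, -q γ^*; γ, α^*]` over the free `*`-algebra. -/
def freeFundamental (q : Set.Ioo (0 : ℝ) 1) : Matrix (Fin 2) (Fin 2) (FreeStar SUGen) :=
  !![.gen .α, -(qc q • star (FreeStar.gen .γ)); .gen .γ, star (FreeStar.gen .α)]

/-- The relations of `O(SU_q(2))`: the matrix `freeFundamental q` is unitary. -/
inductive SURel (q : Set.Ioo (0 : ℝ) 1) : FreeStar SUGen → FreeStar SUGen → Prop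
  | left (i j : Fin 2) :
      SURel q (((freeFundamental q)ᴴ * freeFundamental q) i j)
        ((1 : Matrix (Fin 2) (Fin 2) (FreeStar SUGen)) i j)
  | right (i j : Fin 2) :
      SURel q ((freeFundamental q * (freeFundamental q)ᴴ) i j)
        ((1 : Matrix (Fin 2) (Fin 2) (FreeStar SUGen)) i j)

/-- The `*`-algebra `O(SU_q(2))`. -/
abbrev OSU (q : Set.Ioo (0 : ℝ) 1) : Type := Presented (SURel q)

/-- The generator `α` of `O(SU_q(2))`. -/
def α (q : Set.Ioo (0 : ℝ) 1) : OSU q := Presented.mk (FreeStar.gen .α)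

/-- The generator `γ` of `O(SU_q(2))`. -/
def γ (q : Set.Ioo (0 : ℝ) 1) : OSU q := Presented.mk (FreeStar.gen .γ)

/-- The fundamental corepresentation of `O(SU_q(2))`. -/
def fundamental (q : Set.Ioo (0 : ℝ) 1) : Matrix (Fin 2) (Fin 2) (OSU q) :=
  !![α q, -(qc q • star (γ q)); γ q, star (α q)]

theorem fundamental_eq_map (q : Set.Ioo (0 : ℝ) 1) :
    fundamental q = (freeFundamental q).map Presented.mk := by
  ext i j
  fin_cases i <;> fin_cases j <;>
    simp [fundamental, freeFundamental, α, γ, Presented.mk_star]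

theorem conjTranspose_fundamental (q : Set.Ioo (0 : ℝ) 1) :
    (fundamental q)ᴴ = ((freeFundamental q)ᴴ).map Presented.mk := by
  rw [fundamental_eq_map]
  ext i j
  simp [Presented.mk_star]

theorem fundamental_left (q : Set.Ioo (0 : ℝ) 1) : (fundamental q)ᴴ * fundamental q = 1 := by
  rw [conjTranspose_fundamental, fundamental_eq_map, ← AlgHom.coe_toRingHom, ← Matrix.map_mul]
  ext i j
  rw [Matrix.map_apply]
  refine (Presented.mk_eq (SURel.left i j)).trans ?_
  rcases eq_or_ne i j with rfl | h <;> simp [*]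

theorem fundamental_right (q : Set.Ioo (0 : ℝ) 1) : fundamental q * (fundamental q)ᴴ = 1 := by
  rw [conjTranspose_fundamental, fundamental_eq_map, ← AlgHom.coe_toRingHom, ← Matrix.map_mul]
  ext i j
  rw [Matrix.map_apply]
  refine (Presented.mk_eq (SURel.right i j)).trans ?_
  rcases eq_or_ne i j with rfl | h <;> simp [*]

/-! ### The symplectic quantum 7-sphere -/

/-- The relations of `O(S^7_q)`; the generators `x₁, x₂, x₃, x₄` are numbered from `0`. -/
inductive S7Rel (q : Set.Ioo (0 : ℝ) 1) : FreeStar (Fin 4) → FreeStar (Fin 4) → Prop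
  | x12 : letI Q := qc q; letI x : Fin 4 → FreeStar (Fin 4) := FreeStar.gen
      S7Rel q (x 0 * x 1)
        (Q • (x 1 * x 0))
  | x13 : letI Q := qc q; letI x : Fin 4 → FreeStar (Fin 4) := FreeStar.gen
      S7Rel q (x 0 * x 2)
        (Q • (x 2 * x 0))
  | x14 : letI Q := qc q; letI x : Fin 4 → FreeStar (Fin 4) := FreeStar.gen
      S7Rel q (x 0 * x 3)
        (Q ^ 2 • (x 3 * x 0))
  | x23 : letI Q := qc q; letI x : Fin 4 → FreeStar (Fin 4) := FreeStar.gen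
      S7Rel q (x 1 * x 2)
        (Q ^ 2 • (x 2 * x 1) + (Q ^ 2 * (Q - Q⁻¹)) • (x 3 * x 0))
  | x24 : letI Q := qc q; letI x : Fin 4 → FreeStar (Fin 4) := FreeStar.gen
      S7Rel q (x 1 * x 3)
        (Q • (x 3 * x 1))
  | x34 : letI Q := qc q; letI x : Fin 4 → FreeStar (Fin 4) := FreeStar.gen
      S7Rel q (x 2 * x 3)
        (Q • (x 3 * x 2))
  | s11 : letI x : Fin 4 → FreeStar (Fin 4) := FreeStar.gen
      S7Rel q (star (x 0) * x 0)
        (x 0 * star (x 0))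
  | s12 : letI Q := qc q; letI x : Fin 4 → FreeStar (Fin 4) := FreeStar.gen
      S7Rel q (star (x 0) * x 1)
        (Q • (x 1 * star (x 0)))
  | s13 : letI Q := qc q; letI x : Fin 4 → FreeStar (Fin 4) := FreeStar.gen
      S7Rel q (star (x 0) * x 2)
        (Q • (x 2 * star (x 0)))
  | s14 : letI Q := qc q; letI x : Fin 4 → FreeStar (Fin 4) := FreeStar.gen
      S7Rel q (star (x 0) * x 3)
        (Q ^ 2 • (x 3 * star (x 0)))
  | s22 : letI Q := qc q; letI x : Fin 4 → FreeStar (Fin 4) := FreeStar.gen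
      S7Rel q (star (x 1) * x 1)
        (x 1 * star (x 1) + (1 - Q ^ 2) • (x 0 * star (x 0)))
  | s23 : letI Q := qc q; letI x : Fin 4 → FreeStar (Fin 4) := FreeStar.gen
      S7Rel q (star (x 1) * x 2)
        (Q ^ 2 • (x 2 * star (x 1)))
  | s24 : letI Q := qc q; letI x : Fin 4 → FreeStar (Fin 4) := FreeStar.gen
      S7Rel q (star (x 1) * x 3)
        (Q • (x 3 * star (x 1)) + (Q ^ 2 * (Q - Q⁻¹)) • (x 2 * star (x 0)))
  | s33 : letI Q := qc q; letI x : Fin 4 → FreeStar (Fin 4) := FreeStar.gen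
      S7Rel q (star (x 2) * x 2)
        (x 2 * star (x 2) + (1 - Q ^ 4) • (x 1 * star (x 1)) +
          (1 - Q ^ 2) • (x 0 * star (x 0)))
  | s34 : letI Q := qc q; letI x : Fin 4 → FreeStar (Fin 4) := FreeStar.gen
      S7Rel q (star (x 2) * x 3)
        (Q • (x 3 * star (x 2)) - (Q ^ 4 * (Q - Q⁻¹)) • (x 1 * star (x 0)))
  | sphere : letI x : Fin 4 → FreeStar (Fin 4) := FreeStar.gen
      S7Rel q (x 0 * star (x 0) + x 1 * star (x 1) + x 2 * star (x 2) + x 3 * star (x 3))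
        (1)
  | sphere' : letI Q := qc q; letI x : Fin 4 → FreeStar (Fin 4) := FreeStar.gen
      S7Rel q (Q ^ 8 • (star (x 0) * x 0) + Q ^ 6 • (star (x 1) * x 1) +
          Q ^ 2 • (star (x 2) * x 2) + star (x 3) * x 3)
        (1)

/-- The `*`-algebra `O(S^7_q)` of the symplectic quantum 7-sphere. -/
abbrev OS7 (q : Set.Ioo (0 : ℝ) 1) : Type := Presented (S7Rel q)

/-- The generators of `O(S^7_q)`. -/
def x (q : Set.Ioo (0 : ℝ) 1) (i : Fin 4) : OS7 q := Presented.mk (FreeStar.gen i)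

/-- The `4 × 2` matrix `u` of generators of `O(S^7_q)`. -/
def u (q : Set.Ioo (0 : ℝ) 1) : Matrix (Fin 4) (Fin 2) (OS7 q) :=
  letI Q := qc q
  !![Q • x q 0, Q • x q 1;
    -(Q ^ 2 • star (x q 1)), Q ^ 3 • star (x q 0);
    -x q 2, x q 3;
    star (x q 3), Q • star (x q 2)]


theorem x_x12 (q : Set.Ioo (0 : ℝ) 1) :
    x q 0 * x q 1 = qc q • (x q 1 * x q 0) := by
  have h := Presented.mk_eq (S7Rel.x12 (q := q))
  simp only [map_mul, map_add, map_sub, map_smul, map_one, Presented.mk_star] at h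
  exact h

theorem x_x13 (q : Set.Ioo (0 : ℝ) 1) :
    x q 0 * x q 2 = qc q • (x q 2 * x q 0) := by
  have h := Presented.mk_eq (S7Rel.x13 (q := q))
  simp only [map_mul, map_add, map_sub, map_smul, map_one, Presented.mk_star] at h
  exact h

theorem x_x14 (q : Set.Ioo (0 : ℝ) 1) :
    x q 0 * x q 3 = qc q ^ 2 • (x q 3 * x q 0) := by
  have h := Presented.mk_eq (S7Rel.x14 (q := q))
  simp only [map_mul, map_add, map_sub, map_smul, map_one, Presented.mk_star] at h
  exact h

theorem x_x23 (q : Set.Ioo (0 : ℝ) 1) :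
    x q 1 * x q 2 = qc q ^ 2 • (x q 2 * x q 1) + (qc q ^ 2 * (qc q - (qc q)⁻¹)) • (x q 3 * x q 0) := by
  have h := Presented.mk_eq (S7Rel.x23 (q := q))
  simp only [map_mul, map_add, map_sub, map_smul, map_one, Presented.mk_star] at h
  exact h

theorem x_x24 (q : Set.Ioo (0 : ℝ) 1) :
    x q 1 * x q 3 = qc q • (x q 3 * x q 1) := by
  have h := Presented.mk_eq (S7Rel.x24 (q := q))
  simp only [map_mul, map_add, map_sub, map_smul, map_one, Presented.mk_star] at h
  exact h

theorem x_x34 (q : Set.Ioo (0 : ℝ) 1) :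
    x q 2 * x q 3 = qc q • (x q 3 * x q 2) := by
  have h := Presented.mk_eq (S7Rel.x34 (q := q))
  simp only [map_mul, map_add, map_sub, map_smul, map_one, Presented.mk_star] at h
  exact h

theorem x_s11 (q : Set.Ioo (0 : ℝ) 1) :
    star (x q 0) * x q 0 = x q 0 * star (x q 0) := by
  have h := Presented.mk_eq (S7Rel.s11 (q := q))
  simp only [map_mul, map_add, map_sub, map_smul, map_one, Presented.mk_star] at h
  exact h

theorem x_s12 (q : Set.Ioo (0 : ℝ) 1) :
    star (x q 0) * x q 1 = qc q • (x q 1 * star (x q 0)) := by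
  have h := Presented.mk_eq (S7Rel.s12 (q := q))
  simp only [map_mul, map_add, map_sub, map_smul, map_one, Presented.mk_star] at h
  exact h

theorem x_s13 (q : Set.Ioo (0 : ℝ) 1) :
    star (x q 0) * x q 2 = qc q • (x q 2 * star (x q 0)) := by
  have h := Presented.mk_eq (S7Rel.s13 (q := q))
  simp only [map_mul, map_add, map_sub, map_smul, map_one, Presented.mk_star] at h
  exact h

theorem x_s14 (q : Set.Ioo (0 : ℝ) 1) :
    star (x q 0) * x q 3 = qc q ^ 2 • (x q 3 * star (x q 0)) := by
  have h := Presented.mk_eq (S7Rel.s14 (q := q))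
  simp only [map_mul, map_add, map_sub, map_smul, map_one, Presented.mk_star] at h
  exact h

theorem x_s22 (q : Set.Ioo (0 : ℝ) 1) :
    star (x q 1) * x q 1 = x q 1 * star (x q 1) + (1 - qc q ^ 2) • (x q 0 * star (x q 0)) := by
  have h := Presented.mk_eq (S7Rel.s22 (q := q))
  simp only [map_mul, map_add, map_sub, map_smul, map_one, Presented.mk_star] at h
  exact h

theorem x_s23 (q : Set.Ioo (0 : ℝ) 1) :
    star (x q 1) * x q 2 = qc q ^ 2 • (x q 2 * star (x q 1)) := by
  have h := Presented.mk_eq (S7Rel.s23 (q := q))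
  simp only [map_mul, map_add, map_sub, map_smul, map_one, Presented.mk_star] at h
  exact h

theorem x_s24 (q : Set.Ioo (0 : ℝ) 1) :
    star (x q 1) * x q 3 = qc q • (x q 3 * star (x q 1)) + (qc q ^ 2 * (qc q - (qc q)⁻¹)) • (x q 2 * star (x q 0)) := by
  have h := Presented.mk_eq (S7Rel.s24 (q := q))
  simp only [map_mul, map_add, map_sub, map_smul, map_one, Presented.mk_star] at h
  exact h

theorem x_s33 (q : Set.Ioo (0 : ℝ) 1) :
    star (x q 2) * x q 2 = x q 2 * star (x q 2) + (1 - qc q ^ 4) • (x q 1 * star (x q 1)) +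
          (1 - qc q ^ 2) • (x q 0 * star (x q 0)) := by
  have h := Presented.mk_eq (S7Rel.s33 (q := q))
  simp only [map_mul, map_add, map_sub, map_smul, map_one, Presented.mk_star] at h
  exact h

theorem x_s34 (q : Set.Ioo (0 : ℝ) 1) :
    star (x q 2) * x q 3 = qc q • (x q 3 * star (x q 2)) - (qc q ^ 4 * (qc q - (qc q)⁻¹)) • (x q 1 * star (x q 0)) := by
  have h := Presented.mk_eq (S7Rel.s34 (q := q))
  simp only [map_mul, map_add, map_sub, map_smul, map_one, Presented.mk_star] at h
  exact h

theorem x_sphere (q : Set.Ioo (0 : ℝ) 1) :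
    x q 0 * star (x q 0) + x q 1 * star (x q 1) + x q 2 * star (x q 2) + x q 3 * star (x q 3) = 1 := by
  have h := Presented.mk_eq (S7Rel.sphere (q := q))
  simp only [map_mul, map_add, map_sub, map_smul, map_one, Presented.mk_star] at h
  exact h

theorem x_sphere' (q : Set.Ioo (0 : ℝ) 1) :
    qc q ^ 8 • (star (x q 0) * x q 0) + qc q ^ 6 • (star (x q 1) * x q 1) +
      qc q ^ 2 • (star (x q 2) * x q 2) + star (x q 3) * x q 3 = 1 := by
  have h := Presented.mk_eq (S7Rel.sphere' (q := q))
  simp only [map_mul, map_add, map_sub, map_smul, map_one, Presented.mk_star] at h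
  exact h

theorem qc_ne_zero (q : Set.Ioo (0 : ℝ) 1) : qc q ≠ 0 := by
  unfold qc; exact_mod_cast q.2.1.ne'

theorem star_qc (q : Set.Ioo (0 : ℝ) 1) : star (qc q) = qc q := Complex.conj_ofReal _

theorem adj_mul_α (q : Set.Ioo (0 : ℝ) 1) : star (α q) * α q = 1 - star (γ q) * γ q := by
  have h := congrFun (congrFun (fundamental_left q) 0) 0
  simp [Matrix.mul_apply, fundamental] at h
  exact eq_sub_of_add_eq h

theorem α_mul_adj (q : Set.Ioo (0 : ℝ) 1) :
    α q * star (α q) = 1 - qc q ^ 2 • (star (γ q) * γ q) := by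
  have h := congrFun (congrFun (fundamental_right q) 0) 0
  simp [Matrix.mul_apply, fundamental, star_qc, smul_smul] at h
  rw [pow_two]
  exact eq_sub_of_add_eq h

theorem γ_mul_adj (q : Set.Ioo (0 : ℝ) 1) : γ q * star (γ q) = star (γ q) * γ q := by
  have h := congrFun (congrFun (fundamental_right q) 1) 1
  simp [Matrix.mul_apply, fundamental, adj_mul_α] at h
  rw [← sub_eq_zero, ← sub_eq_zero.2 h]
  abel

theorem α_mul_adj_γ (q : Set.Ioo (0 : ℝ) 1) :
    α q * star (γ q) = qc q • (star (γ q) * α q) := by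
  have h := congrFun (congrFun (fundamental_right q) 0) 1
  simp [Matrix.mul_apply, fundamental] at h
  exact eq_of_sub_eq_zero (by rw [sub_eq_add_neg]; exact h)

theorem adj_α_mul_adj_γ (q : Set.Ioo (0 : ℝ) 1) :
    star (α q) * star (γ q) = (qc q)⁻¹ • (star (γ q) * star (α q)) := by
  have h := congrFun (congrFun (fundamental_left q) 0) 1
  simp [Matrix.mul_apply, fundamental] at h
  rw [eq_inv_smul_iff₀ (qc_ne_zero q)]
  exact (eq_of_sub_eq_zero (by rw [sub_eq_add_neg, add_comm]; exact h)).symm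

theorem α_mul_γ (q : Set.Ioo (0 : ℝ) 1) : α q * γ q = qc q • (γ q * α q) := by
  have h := congrArg star (adj_α_mul_adj_γ q)
  simp [star_qc] at h
  rw [h, smul_smul, mul_inv_cancel₀ (qc_ne_zero q), one_smul]

theorem adj_α_mul_γ (q : Set.Ioo (0 : ℝ) 1) :
    star (α q) * γ q = (qc q)⁻¹ • (γ q * star (α q)) := by
  have h := congrArg star (α_mul_adj_γ q)
  simp [star_qc] at h
  rw [h, smul_smul, inv_mul_cancel₀ (qc_ne_zero q), one_smul]

/-! ### The coaction of `SU_q(2)` on the 7-sphere -/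

/-- The images of the generators under the coaction. -/
def coactionGen (q : Set.Ioo (0 : ℝ) 1) : Fin 4 → OS7 q ⊗[ℂ] OSU q :=
  ![x q 0 ⊗ₜ α q + x q 1 ⊗ₜ γ q,
    x q 1 ⊗ₜ star (α q) - qc q • (x q 0 ⊗ₜ star (γ q)),
    x q 2 ⊗ₜ α q - x q 3 ⊗ₜ γ q,
    x q 3 ⊗ₜ star (α q) + qc q • (x q 2 ⊗ₜ star (γ q))]

theorem coactionGen_rel (q : Set.Ioo (0 : ℝ) 1) (a b : FreeStar (Fin 4)) (h : S7Rel q a b) :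
    FreeStar.liftHom (coactionGen q) a = FreeStar.liftHom (coactionGen q) b := by
  have hq := qc_ne_zero q
  have b1 := congrArg star (x_s12 q)
  have b2 := congrArg star (x_s13 q)
  have b3 := congrArg star (x_s14 q)
  have b4 := congrArg star (x_s23 q)
  have b5 := congrArg star (x_s24 q)
  have b6 := congrArg star (x_s34 q)
  have c1 := eq_sub_of_add_eq' (x_sphere q)
  have c2 := eq_sub_of_add_eq' (x_sphere' q)
  simp only [x_s11, x_s22, x_s33] at c2
  simp only [star_mul, star_smul, star_add, star_sub, star_star, star_qc, star_pow, star_inv₀]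
    at b1 b2 b3 b4 b5 b6
  cases h <;>
  simp only [map_mul, map_smul, map_add, map_sub, map_one, FreeStar.liftHom_star,
    FreeStar.liftHom_gen, coactionGen, Matrix.cons_val, star_smul, star_add, star_sub,
    star_star, star_qc, TensorProduct.star_tmul, add_mul, mul_add, sub_mul, mul_sub,
    smul_mul_assoc, mul_smul_comm, Algebra.TensorProduct.tmul_mul_tmul, smul_add, smul_sub,
    smul_smul, x_x12, x_x13, x_x14, x_x23, x_x24, x_x34, x_s11, x_s12, x_s13, x_s14, x_s22, x_s23,
    x_s24, x_s33, x_s34, b1, b2, b3, b4, b5, b6, c1, c2, adj_mul_α,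
    α_mul_adj, γ_mul_adj, α_mul_adj_γ, adj_α_mul_adj_γ, α_mul_γ, adj_α_mul_γ,
    TensorProduct.tmul_add, TensorProduct.tmul_sub, TensorProduct.add_tmul, TensorProduct.sub_tmul,
    TensorProduct.tmul_smul, ← TensorProduct.smul_tmul', Algebra.TensorProduct.one_def] <;>
  match_scalars <;> (try field_simp) <;> ring

/-- The right coaction `δ_R : O(S^7_q) → O(S^7_q) ⊗ O(SU_q(2))`, a homomorphism of `*`-algebras; it
is determined by `δ_R(u) = u ⊗ fundamental`, see `coaction_u`. -/
def coaction (q : Set.Ioo (0 : ℝ) 1) : OS7 q →⋆ₐ[ℂ] OS7 q ⊗[ℂ] OSU q :=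
  Presented.lift (coactionGen q) (coactionGen_rel q)

theorem coaction_x (q : Set.Ioo (0 : ℝ) 1) (i : Fin 4) : coaction q (x q i) = coactionGen q i :=
  Presented.lift_mk_gen _ _ i

theorem coaction_u (q : Set.Ioo (0 : ℝ) 1) (i : Fin 4) (k : Fin 2) :
    coaction q (u q i k) = ∑ j, u q i j ⊗ₜ[ℂ] fundamental q j k := by
  fin_cases i <;> fin_cases k <;>
    simp [u, fundamental, map_star, coaction_x, coactionGen, star_qc, TensorProduct.tmul_smul,
      TensorProduct.tmul_neg, TensorProduct.neg_tmul, ← TensorProduct.smul_tmul'] <;>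
    module

/-- The `*`-algebra `O(S^4_q)` of coinvariant elements, `δ_R(b) = b ⊗ 1`. -/
def OS4 (q : Set.Ioo (0 : ℝ) 1) : StarSubalgebra ℂ (OS7 q) where
  carrier := {b | coaction q b = b ⊗ₜ[ℂ] 1}
  mul_mem' {a b} ha hb := by
    simp only [Set.mem_ofPred_eq] at *
    rw [map_mul, ha, hb, Algebra.TensorProduct.tmul_mul_tmul, one_mul]
  add_mem' {a b} ha hb := by
    simp only [Set.mem_ofPred_eq] at *
    rw [map_add, ha, hb, TensorProduct.add_tmul]
  algebraMap_mem' c := by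
    simp only [Set.mem_ofPred_eq]
    rw [AlgHomClass.commutes, Algebra.TensorProduct.algebraMap_apply]
  star_mem' {a} ha := by
    simp only [Set.mem_ofPred_eq] at *
    rw [map_star, ha, TensorProduct.star_tmul, star_one]

/-! ### The matrices `U⁽ⁿ⁾`, `W⁽ⁿ⁾` and the corepresentations `T⁽ⁿ⁾` -/

/-- The `q`-number `[n] = (1 - q^{2n}) / (1 - q^2)`. -/
def qnum (q : Set.Ioo (0 : ℝ) 1) (n : ℕ) : ℝ := (1 - (q : ℝ) ^ (2 * n)) / (1 - (q : ℝ) ^ 2)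

/-- The `q`-binomial coefficient, for `k ≤ n`. -/
def qbinom (q : Set.Ioo (0 : ℝ) 1) (n k : ℕ) : ℝ :=
  (∏ i ∈ Finset.Icc (k + 1) n, (1 - (q : ℝ) ^ (2 * i))) /
    ∏ j ∈ Finset.Icc 1 (n - k), (1 - (q : ℝ) ^ (2 * j))

/-- The square root of a real number, as a complex scalar. -/
def csqrt (r : ℝ) : ℂ := (Real.sqrt r : ℝ)

/-- The column vector `v • w` with entries `v_i w_j`; a multi-index in `{1, …, 4}^{n+1}` is a pair
consisting of its first entry and of the remaining `n` entries. -/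
def bullet {A : Type} [Mul A] {n : ℕ} (v : Fin 4 → A) (w : (Fin n → Fin 4) → A) :
    (Fin (n + 1) → Fin 4) → A :=
  fun I => v (I 0) * w (Fin.tail I)

/-- The `j`-th column of a matrix. -/
def col {A ι κ : Type} (M : Matrix ι κ A) (k : κ) : ι → A := fun i => M i k

/-- The matrix `U⁽ⁿ⁾`, given by its columns, with `U⁽⁰⁾ = (1)` and
`U⁽ⁿ⁾ᵏ = [n]^{-1/2} (q^k [n-k]^{1/2} u⁰ • U⁽ⁿ⁻¹⁾ᵏ + [k]^{1/2} u¹ • U⁽ⁿ⁻¹⁾ᵏ⁻¹)`,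
the columns of `U⁽ⁿ⁻¹⁾` of index `n` and `-1` being zero. In particular `U⁽¹⁾ = u`, see `U_one`. -/
def U (q : Set.Ioo (0 : ℝ) 1) : (n : ℕ) → Matrix (Fin n → Fin 4) (Fin (n + 1)) (OS7 q)
  | 0 => fun _ _ => 1
  | n + 1 => fun I k =>
      (csqrt (qnum q (n + 1)))⁻¹ •
        ((qc q ^ (k : ℕ) * csqrt (qnum q (n + 1 - (k : ℕ)))) •
            bullet (col (u q) 0) (Fin.snoc (α := fun _ => (Fin n → Fin 4) → OS7 q)
              (col (U q n)) 0 k) I +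
          csqrt (qnum q k) •
            bullet (col (u q) 1) (Fin.cons (α := fun _ => (Fin n → Fin 4) → OS7 q)
              0 (col (U q n)) k) I)

theorem csqrt_qnum_one (q : Set.Ioo (0 : ℝ) 1) : csqrt (qnum q 1) = 1 := by
  have h : 1 - (q : ℝ) ^ 2 ≠ 0 := by
    have h1 := q.2.1
    have h2 := q.2.2
    nlinarith
  simp [csqrt, qnum, div_self h]

theorem csqrt_qnum_zero (q : Set.Ioo (0 : ℝ) 1) : csqrt (qnum q 0) = 0 := by
  simp [csqrt, qnum]

theorem U_one (q : Set.Ioo (0 : ℝ) 1) (I : Fin 1 → Fin 4) (k : Fin 2) :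
    U q 1 I k = u q (I 0) k := by
  fin_cases k
  · simp [U, bullet, col, csqrt_qnum_one, csqrt_qnum_zero, Fin.snoc]
  · simp [U, bullet, col, csqrt_qnum_one, csqrt_qnum_zero]

/-- The matrix `W⁽ⁿ⁾`, given by its columns
`W⁽ⁿ⁾ᵏ = [n+2]^{-1/2} ([k+1]^{1/2} u⁰ • U⁽ⁿ⁺¹⁾ᵏ⁺¹ - q^{k+1} [n+1-k]^{1/2} u¹ • U⁽ⁿ⁺¹⁾ᵏ)`. -/
def W (q : Set.Ioo (0 : ℝ) 1) (n : ℕ) : Matrix (Fin (n + 2) → Fin 4) (Fin (n + 1)) (OS7 q) :=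
  fun I k =>
    (csqrt (qnum q (n + 2)))⁻¹ •
      (csqrt (qnum q ((k : ℕ) + 1)) • bullet (col (u q) 0) (col (U q (n + 1)) k.succ) I -
        (qc q ^ ((k : ℕ) + 1) * csqrt (qnum q (n + 1 - (k : ℕ)))) •
          bullet (col (u q) 1) (col (U q (n + 1)) k.castSucc) I)

/-- The matrix `T⁽ⁿ⁾` of the unitary irreducible corepresentation of `O(SU_q(2))` of dimension
`n + 1`. Its entry `t_k^j` in row `k` and column `j` (both numbered from `0`) is
`([n choose k] / [n choose j])^{1/2} ∑_{r + s = j, r ≤ k, s ≤ n - k} [k choose r] [n - k choose s]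
  (-q)^s q^{s (k - r)} (α^*)^r γ^{k-r} (γ^*)^s α^{n-k-s}`.
These are the coefficients obtained on expanding `Δ(t_k^0) = ∑_j t_k^j ⊗ t_j^0`, where
`t_k^0 = [n choose k]^{1/2} γ^k α^{n-k}` and `Δ` is given by `Δ(α) = α ⊗ α - q γ^* ⊗ γ` and
`Δ(γ) = γ ⊗ α + α^* ⊗ γ`. -/
def T (q : Set.Ioo (0 : ℝ) 1) (n : ℕ) : Matrix (Fin (n + 1)) (Fin (n + 1)) (OSU q) :=
  fun k j =>
    (csqrt (qbinom q n k) / csqrt (qbinom q n j)) •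
      ∑ r ∈ Finset.range ((k : ℕ) + 1), ∑ s ∈ Finset.range (n - (k : ℕ) + 1),
        if r + s = (j : ℕ) then
          ((qbinom q k r : ℂ) * (qbinom q (n - (k : ℕ)) s : ℂ) * (-qc q) ^ s * qc q ^ (s * ((k : ℕ) - r))) •
            (star (α q) ^ r * γ q ^ ((k : ℕ) - r) * star (γ q) ^ s * α q ^ (n - (k : ℕ) - s))
        else 0

theorem T_one (q : Set.Ioo (0 : ℝ) 1) : T q 1 = fundamental q := by
  have h1 : ∀ k, k ≤ 1 → qbinom q 1 k = 1 := by
    have h : 1 - (q : ℝ) ^ 2 ≠ 0 := by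
      have h1 := q.2.1
      have h2 := q.2.2
      nlinarith
    intro k hk
    interval_cases k <;> simp [qbinom, div_self h]
  have h0 : qbinom q 0 0 = 1 := by simp [qbinom]
  have hs : csqrt 1 = 1 := by simp [csqrt]
  ext k j
  fin_cases k <;> fin_cases j <;>
    simp [T, fundamental, Finset.sum_range_succ, h1, h0, hs]

/-! ### The associated modules -/

/-- `O(S^7_q)` as a right module over `O(S^4_q)`. -/
instance (q : Set.Ioo (0 : ℝ) 1) : Module (OS4 q)ᵐᵒᵖ (OS7 q) :=
  Module.compHom (OS7 q) (RingHom.op ((OS4 q).subtype : OS4 q →+* OS7 q))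

theorem op_smul_eq (q : Set.Ioo (0 : ℝ) 1) (b : OS4 q) (a : OS7 q) :
    MulOpposite.op b • a = a * (b : OS7 q) := rfl

instance (q : Set.Ioo (0 : ℝ) 1) : SMulCommClass ℂ (OS4 q)ᵐᵒᵖ (OS7 q) where
  smul_comm c b a := (smul_mul_assoc c a (b.unop : OS7 q)).symm

section Cotensor

variable (q : Set.Ioo (0 : ℝ) 1) {V : Type} [AddCommGroup V] [Module ℂ V]

/-- The map `δ_R ⊗ id : O(S^7_q) ⊗ V → O(S^7_q) ⊗ O(SU_q(2)) ⊗ V`. -/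
def coactLeft : OS7 q ⊗[ℂ] V →ₗ[ℂ] OS7 q ⊗[ℂ] (OSU q ⊗[ℂ] V) :=
  (TensorProduct.assoc ℂ (OS7 q) (OSU q) V).toLinearMap ∘ₗ
    LinearMap.rTensor V (coaction q).toAlgHom.toLinearMap

/-- The map `id ⊗ δ_L : O(S^7_q) ⊗ V → O(S^7_q) ⊗ O(SU_q(2)) ⊗ V`. -/
def coactRight (δL : V →ₗ[ℂ] OSU q ⊗[ℂ] V) : OS7 q ⊗[ℂ] V →ₗ[ℂ] OS7 q ⊗[ℂ] (OSU q ⊗[ℂ] V) :=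
  LinearMap.lTensor (OS7 q) δL

theorem coactLeft_smul (b : (OS4 q)ᵐᵒᵖ) (z : OS7 q ⊗[ℂ] V) :
    coactLeft q (b • z) = b • coactLeft q z := by
  obtain ⟨⟨b, hb⟩, rfl⟩ := MulOpposite.op_surjective b
  induction z using TensorProduct.induction_on with
  | zero => simp
  | add y z hy hz => rw [smul_add, map_add, hy, hz, map_add, smul_add]
  | tmul a v =>
    have key : ∀ w : OS7 q ⊗[ℂ] OSU q,
        TensorProduct.assoc ℂ (OS7 q) (OSU q) V ((w * (b ⊗ₜ[ℂ] 1)) ⊗ₜ[ℂ] v) =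
          MulOpposite.op (⟨b, hb⟩ : OS4 q) •
            TensorProduct.assoc ℂ (OS7 q) (OSU q) V (w ⊗ₜ[ℂ] v) := by
      intro w
      induction w using TensorProduct.induction_on with
      | zero => simp
      | add y z hy hz =>
        rw [add_mul, TensorProduct.add_tmul, map_add, hy, hz, TensorProduct.add_tmul, map_add,
          smul_add]
      | tmul a h =>
        rw [Algebra.TensorProduct.tmul_mul_tmul, mul_one, TensorProduct.assoc_tmul,
          TensorProduct.assoc_tmul, TensorProduct.smul_tmul', op_smul_eq]
    rw [TensorProduct.smul_tmul', op_smul_eq]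
    have h : coaction q (a * b) = coaction q a * (b ⊗ₜ[ℂ] 1) := by
      rw [map_mul]
      exact congrArg _ hb
    have e : ∀ c : OS7 q, coactLeft q (c ⊗ₜ[ℂ] v) =
        TensorProduct.assoc ℂ (OS7 q) (OSU q) V (coaction q c ⊗ₜ[ℂ] v) := fun c => rfl
    rw [e, e, h, key]

theorem coactRight_smul (δL : V →ₗ[ℂ] OSU q ⊗[ℂ] V) (b : (OS4 q)ᵐᵒᵖ) (z : OS7 q ⊗[ℂ] V) :
    coactRight q δL (b • z) = b • coactRight q δL z := by
  induction z using TensorProduct.induction_on with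
  | zero => simp
  | add y z hy hz => rw [smul_add, map_add, hy, hz, map_add, smul_add]
  | tmul a v =>
    rw [TensorProduct.smul_tmul', coactRight, LinearMap.lTensor_tmul, LinearMap.lTensor_tmul,
      TensorProduct.smul_tmul']

/-- The cotensor product `O(S^7_q) □ V` with a left `O(SU_q(2))`-comodule `(V, δ_L)`, as a right
`O(S^4_q)`-module: the equalizer of `δ_R ⊗ id` and `id ⊗ δ_L` in `O(S^7_q) ⊗ V`. -/
def cotensor (δL : V →ₗ[ℂ] OSU q ⊗[ℂ] V) : Submodule (OS4 q)ᵐᵒᵖ (OS7 q ⊗[ℂ] V) where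
  carrier := {z | coactLeft q z = coactRight q δL z}
  add_mem' {y z} hy hz := by
    simp only [Set.mem_ofPred_eq] at *
    rw [map_add, map_add, hy, hz]
  zero_mem' := by simp
  smul_mem' b z hz := by
    simp only [Set.mem_ofPred_eq] at *
    rw [coactLeft_smul, coactRight_smul, hz]

end Cotensor

/-- The left coaction `δ_L(e_i) = ∑_j t_i^j ⊗ e_j` on `V_n = ℂ^{n+1}` defined by `T⁽ⁿ⁾`. -/
def leftCoaction (q : Set.Ioo (0 : ℝ) 1) (n : ℕ) :
    (Fin (n + 1) → ℂ) →ₗ[ℂ] OSU q ⊗[ℂ] (Fin (n + 1) → ℂ) :=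
  (Pi.basisFun ℂ (Fin (n + 1))).constr ℂ fun i => ∑ j, T q n i j ⊗ₜ[ℂ] Pi.single j (1 : ℂ)

/-- The right `O(S^4_q)`-module `ℰ_n = O(S^7_q) □ V_n`. -/
abbrev E (q : Set.Ioo (0 : ℝ) 1) (n : ℕ) :
    Submodule (OS4 q)ᵐᵒᵖ (OS7 q ⊗[ℂ] (Fin (n + 1) → ℂ)) :=
  cotensor q (leftCoaction q n)

/-- The right `B`-module `p B^N` of a square matrix `p` with entries in a ring `B`. -/
abbrev rangeModule {B N : Type} [Ring B] [Fintype N] (p : Matrix N N B) :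
    Submodule Bᵐᵒᵖ (N → B) :=
  LinearMap.range (Matrix.mulVecBilin B Bᵐᵒᵖ p)

end QuantumSphere

end

open QuantumSphere

/-! Both families of matrices are obtained from `u` by Clebsch–Gordan isometries. With `⊗` the
Kronecker product over the noncommutative algebra, `U_succ` and `W_eq` give, up to reindexing,
U⁽ⁿ⁺¹⁾ = (u ⊗ U⁽ⁿ⁾) C and W⁽ⁿ⁾ = (u ⊗ U⁽ⁿ⁺¹⁾) D, where C = `raiseCG` and D = `lowerCG` are complex
matrices. Since u*u = 1 (`u_isometry`) and Kronecker products of isometries are isometries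
(`kronecker_isometry`), claims 1 and 2 reduce to the scalar identities D*D = 1 and D*C = 0, together
with C*C = 1 for the isometry of U⁽ⁿ⁾. These follow from [n] = [k] + q^{2k}[n-k].

Covariance follows by induction once C and D are known to intertwine T⁽¹⁾ ⊗ T⁽ⁿ⁾ with T⁽ⁿ⁺¹⁾ and
T⁽¹⁾ ⊗ T⁽ⁿ⁺¹⁾ with T⁽ⁿ⁾ (`kronecker_T_mul_raiseCG`, `kronecker_T_mul_lowerCG`). In the quantum plane
ac = q ca put A = α ⊗ a - q γ* ⊗ c and B = γ ⊗ a + α* ⊗ c, so that AB = q BA. By the q-binomial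
theorem, row k of T⁽ⁿ⁾ consists, up to normalization, of the coefficients of B^k A^{n-k}
(`T_eq_planeCoeff`). The relation for C is then left multiplication by A and B; the relation for D
is the action of two q-difference operators that lower the exponents of B and of A.

Completeness CC* + DD* = 1 transfers T T* = 1 from T⁽¹⁾ ⊗ T⁽ⁿ⁺¹⁾ to T⁽ⁿ⁺²⁾ (`T_coisometry`). Hence M
N* has coinvariant entries whenever M and N are covariant for the same T⁽ⁿ⁾, which covers P, Q and V
= U W*. The relations for V and the projection property use only U*U = 1 and W*W = 1. Finally, T⁽ⁿ⁾
is equivalent to its conjugate (`star_T`), so an element of ℰ_n becomes, after reversing and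
rescaling its coordinates, a column y whose adjoint is covariant; the isomorphism is y ↦ W y, with
inverse induced by W*. -/

noncomputable section

namespace QuantumSphere

/-! ### `q`-numbers, `q`-factorials and the `q`-Pascal rule -/

section Scalars

variable (q : Set.Ioo (0 : ℝ) 1)

theorem one_sub_pow_pos {n : ℕ} (hn : n ≠ 0) : 0 < 1 - (q : ℝ) ^ (2 * n) :=
  sub_pos.2 (pow_lt_one₀ q.2.1.le q.2.2 (by omega))

theorem one_sub_sq_pos : 0 < 1 - (q : ℝ) ^ 2 := one_sub_pow_pos q one_ne_zero

theorem one_sub_qc_sq_ne_zero : 1 - qc q ^ 2 ≠ 0 := by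
  unfold qc
  exact_mod_cast (one_sub_sq_pos q).ne'

theorem qnum_pos {n : ℕ} (hn : n ≠ 0) : 0 < qnum q n :=
  div_pos (one_sub_pow_pos q hn) (one_sub_sq_pos q)

theorem qnum_zero : qnum q 0 = 0 := by simp [qnum]

theorem qnum_nonneg (n : ℕ) : 0 ≤ qnum q n := by
  rcases eq_or_ne n 0 with rfl | h
  · rw [qnum_zero]
  · exact (qnum_pos q h).le

theorem csqrt_mul_self {r : ℝ} (hr : 0 ≤ r) : csqrt r * csqrt r = r := by
  unfold csqrt
  exact_mod_cast Real.mul_self_sqrt hr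

theorem csqrt_ne_zero {r : ℝ} (hr : 0 < r) : csqrt r ≠ 0 := by
  unfold csqrt
  exact_mod_cast (Real.sqrt_pos.2 hr).ne'

theorem star_csqrt (r : ℝ) : star (csqrt r) = csqrt r := Complex.conj_ofReal _

theorem csqrt_qnum_mul_self (n : ℕ) : csqrt (qnum q n) * csqrt (qnum q n) = qnum q n :=
  csqrt_mul_self (qnum_nonneg q n)

theorem csqrt_qnum_succ_ne_zero (n : ℕ) : csqrt (qnum q (n + 1)) ≠ 0 :=
  csqrt_ne_zero (qnum_pos q n.succ_ne_zero)

/-- The square root of the `q`-factorial. -/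
def sqrtFact : ℕ → ℂ
  | 0 => 1
  | n + 1 => csqrt (qnum q (n + 1)) * sqrtFact n

theorem sqrtFact_ne_zero (n : ℕ) : sqrtFact q n ≠ 0 := by
  induction n with
  | zero => exact one_ne_zero
  | succ n ih => exact mul_ne_zero (csqrt_qnum_succ_ne_zero q n) ih

theorem qbinom_self (n : ℕ) : qbinom q n n = 1 := by simp [qbinom]

theorem prod_Icc_one_ne_zero (n : ℕ) : ∏ j ∈ Finset.Icc 1 n, (1 - (q : ℝ) ^ (2 * j)) ≠ 0 :=
  Finset.prod_ne_zero_iff.2 fun j hj => (one_sub_pow_pos q (by simp at hj; omega)).ne'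

theorem qbinom_zero (n : ℕ) : qbinom q n 0 = 1 := by
  simp [qbinom, div_self (prod_Icc_one_ne_zero q n)]

theorem qbinom_eq_div {n k : ℕ} (h : k ≤ n) : qbinom q n k =
    (∏ j ∈ Finset.Icc 1 n, (1 - (q : ℝ) ^ (2 * j))) /
      ((∏ j ∈ Finset.Icc 1 k, (1 - (q : ℝ) ^ (2 * j))) *
        ∏ j ∈ Finset.Icc 1 (n - k), (1 - (q : ℝ) ^ (2 * j))) := by
  have h1 : (∏ j ∈ Finset.Icc 1 k, (1 - (q : ℝ) ^ (2 * j))) *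
      ∏ j ∈ Finset.Icc (k + 1) n, (1 - (q : ℝ) ^ (2 * j)) =
      ∏ j ∈ Finset.Icc 1 n, (1 - (q : ℝ) ^ (2 * j)) := by
    have := Finset.prod_Ioc_consecutive (fun j => 1 - (q : ℝ) ^ (2 * j)) (Nat.zero_le k) h
    simpa only [← Finset.Icc_add_one_left_eq_Ioc, zero_add] using this
  rw [qbinom, ← h1, mul_div_mul_left _ _ (prod_Icc_one_ne_zero q k)]

/-- Each factor is 1 - q^{2j} = (1 - q²)[j]. In a binomial quotient the powers of 1 - q² cancel,
which leaves q-factorials. -/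
theorem prod_Icc_one_eq (n : ℕ) : ((∏ j ∈ Finset.Icc 1 n, (1 - (q : ℝ) ^ (2 * j)) : ℝ) : ℂ) =
    ((1 - (q : ℝ) ^ 2 : ℝ) : ℂ) ^ n * sqrtFact q n ^ 2 := by
  induction n with
  | zero => simp [sqrtFact]
  | succ n ih =>
    have h := csqrt_qnum_mul_self q (n + 1)
    have h2 : ((1 - (q : ℝ) ^ 2 : ℝ) : ℂ) * qnum q (n + 1) = (1 - (q : ℝ) ^ (2 * (n + 1)) : ℝ) := by
      rw [← Complex.ofReal_mul, qnum, mul_div_cancel₀ _ (one_sub_sq_pos q).ne']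
    rw [Finset.prod_Icc_succ_top (by omega), Complex.ofReal_mul, ih, ← h2, ← h, sqrtFact]
    ring

theorem qbinom_eq_sqrtFact {n k : ℕ} (h : k ≤ n) : (qbinom q n k : ℂ) =
    (sqrtFact q n / (sqrtFact q k * sqrtFact q (n - k))) ^ 2 := by
  have h0 : ((1 - (q : ℝ) ^ 2 : ℝ) : ℂ) ≠ 0 := Complex.ofReal_ne_zero.2 (one_sub_sq_pos q).ne'
  have h1 := sqrtFact_ne_zero q k
  have h2 := sqrtFact_ne_zero q (n - k)
  rw [qbinom_eq_div q h, Complex.ofReal_div, Complex.ofReal_mul, prod_Icc_one_eq, prod_Icc_one_eq,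
    prod_Icc_one_eq]
  obtain ⟨m, rfl⟩ := Nat.exists_eq_add_of_le h
  rw [Nat.add_sub_cancel_left, pow_add] at *
  field_simp

/-- Positivity fixes the sign when the square root of a q-binomial coefficient is extracted in
`csqrt_qbinom`. -/
theorem sqrtFact_eq_ofReal (n : ℕ) : ∃ r : ℝ, 0 < r ∧ sqrtFact q n = r := by
  induction n with
  | zero => exact ⟨1, one_pos, by simp [sqrtFact]⟩
  | succ n ih =>
    obtain ⟨r, hr, h⟩ := ih
    exact ⟨Real.sqrt (qnum q (n + 1)) * r,
      mul_pos (Real.sqrt_pos.2 (qnum_pos q n.succ_ne_zero)) hr, by simp [sqrtFact, h, csqrt]⟩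

theorem csqrt_qbinom {n k : ℕ} (h : k ≤ n) : csqrt (qbinom q n k) =
    sqrtFact q n / (sqrtFact q k * sqrtFact q (n - k)) := by
  obtain ⟨a, ha, ha'⟩ := sqrtFact_eq_ofReal q n
  obtain ⟨b, hb, hb'⟩ := sqrtFact_eq_ofReal q k
  obtain ⟨c, hc, hc'⟩ := sqrtFact_eq_ofReal q (n - k)
  have h1 := qbinom_eq_sqrtFact q h
  rw [ha', hb', hc'] at *
  have h2 : qbinom q n k = (a / (b * c)) ^ 2 := by exact_mod_cast h1
  rw [csqrt, h2, Real.sqrt_sq (by positivity)]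
  push_cast
  rfl

theorem qbinom_symm {n k : ℕ} (h : k ≤ n) : qbinom q n (n - k) = qbinom q n k := by
  rw [qbinom_eq_div q h, qbinom_eq_div q (Nat.sub_le n k), Nat.sub_sub_self h, mul_comm]

/-- The case k = n is excluded: there `qbinom q n (n + 1)` is a quotient of empty products, hence 1
instead of the expected 0. -/
theorem qbinom_pascal {n k : ℕ} (h : k < n) : qbinom q (n + 1) (k + 1) =
    (q : ℝ) ^ (2 * (k + 1)) * qbinom q n (k + 1) + qbinom q n k := by
  obtain ⟨m, rfl⟩ := Nat.exists_eq_add_of_lt h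
  have e1 : k + m + 1 + 1 - (k + 1) = m + 1 := by omega
  have e2 : k + m + 1 - (k + 1) = m := by omega
  have e3 : k + m + 1 - k = m + 1 := by omega
  rw [qbinom_eq_div q (by omega), qbinom_eq_div q (by omega), qbinom_eq_div q (by omega), e1, e2, e3]
  have h1 := prod_Icc_one_ne_zero q k
  have h2 := prod_Icc_one_ne_zero q m
  have h3 := (one_sub_pow_pos q k.succ_ne_zero).ne'
  have h4 := (one_sub_pow_pos q m.succ_ne_zero).ne'
  simp only [Finset.prod_Icc_succ_top (Nat.le_add_left 1 _)]
  field_simp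
  ring

/-- The `q`-Pascal rule, in the form used in the `q`-binomial theorem. -/
theorem sum_qbinom_succ {M : Type*} [AddCommGroup M] [Module ℂ M] (k : ℕ) (X : ℕ → M) :
    ∑ r ∈ Finset.range (k + 1), (qbinom q k r : ℂ) • (qc q ^ (2 * r) • X r + X (r + 1)) =
      ∑ r ∈ Finset.range (k + 2), (qbinom q (k + 1) r : ℂ) • X r := by
  have h : ∀ r ∈ Finset.range k, (qbinom q (k + 1) (r + 1) : ℂ) • X (r + 1) =
      (qbinom q k (r + 1) : ℂ) • qc q ^ (2 * (r + 1)) • X (r + 1) +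
        (qbinom q k r : ℂ) • X (r + 1) := by
    intro r hr
    rw [qbinom_pascal q (Finset.mem_range.1 hr), smul_smul, ← add_smul]
    congr 1
    simp [qc]
    ring
  -- The terms r = 0 and r = k + 1 are split off, since the Pascal rule is available only for the
  -- inner ones; their coefficients are 1 on both sides.
  rw [Finset.sum_range_succ' _ (k + 1), Finset.sum_range_succ (fun r => _ • X (r + 1)) k,
    Finset.sum_congr rfl h]
  simp only [smul_add, Finset.sum_add_distrib]
  rw [Finset.sum_range_succ' (fun r => (qbinom q k r : ℂ) • qc q ^ (2 * r) • X r),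
    Finset.sum_range_succ (fun r => (qbinom q k r : ℂ) • X (r + 1))]
  simp only [qbinom_zero, qbinom_self]
  simp
  abel

/-- The `q`-number of an integer, as a complex scalar. -/
def qint (k : ℤ) : ℂ := (1 - qc q ^ (2 * k)) / (1 - qc q ^ 2)

theorem qint_natCast (n : ℕ) : qint q n = qnum q n := by
  have h : qc q ^ (2 * (n : ℤ)) = qc q ^ (2 * n) := by
    rw [← zpow_natCast, Nat.cast_mul, Nat.cast_ofNat]
  simp only [qint, qnum, h]
  simp [qc]

theorem qnum_add (m n : ℕ) :
    qnum q (m + n) = qnum q m + (q : ℝ) ^ (2 * m) * qnum q n := by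
  have := (one_sub_sq_pos q).ne'
  simp only [qnum]
  field_simp
  ring

end Scalars

/-! ### The coaction on the quantum plane

A sequence `f : ℤ → OSU q` stands for the element `∑ⱼ f j ⊗ c^j a^(d-j)` of degree `d` of the
quantum plane `ac = q ca` with coefficients in `OSU q`. -/

section Plane

variable (q : Set.Ioo (0 : ℝ) 1)

/-- Left multiplication by `α ⊗ a - q γ^* ⊗ c`. -/
def planeA : (ℤ → OSU q) →ₗ[ℂ] (ℤ → OSU q) where
  toFun f j := qc q ^ j • (α q * f j) - qc q • (star (γ q) * f (j - 1))
  map_add' f g := by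
    ext j
    simp only [Pi.add_apply, mul_add, smul_add]
    abel
  map_smul' c f := by
    ext j
    simp only [Pi.smul_apply, mul_smul_comm, smul_sub, RingHom.id_apply, smul_comm c]

/-- Left multiplication by `γ ⊗ a + α^* ⊗ c`. -/
def planeB : (ℤ → OSU q) →ₗ[ℂ] (ℤ → OSU q) where
  toFun f j := qc q ^ j • (γ q * f j) + star (α q) * f (j - 1)
  map_add' f g := by
    ext j
    simp only [Pi.add_apply, mul_add, smul_add]
    abel
  map_smul' c f := by
    ext j
    simp only [Pi.smul_apply, mul_smul_comm, smul_add, RingHom.id_apply, smul_comm c]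

theorem planeA_apply (f : ℤ → OSU q) (j : ℤ) :
    planeA q f j = qc q ^ j • (α q * f j) - qc q • (star (γ q) * f (j - 1)) := rfl

theorem planeB_apply (f : ℤ → OSU q) (j : ℤ) :
    planeB q f j = qc q ^ j • (γ q * f j) + star (α q) * f (j - 1) := rfl

/-- The coefficients of `(γ ⊗ a + α^* ⊗ c)^k (α ⊗ a - q γ^* ⊗ c)^m`. -/
def planeCoeff (k m : ℕ) : ℤ → OSU q :=
  (planeB q ^ k) ((planeA q ^ m) (Pi.single 0 1))

theorem planeCoeff_zero_zero : planeCoeff q 0 0 = Pi.single 0 1 := rfl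

theorem planeCoeff_succ_left (k m : ℕ) :
    planeCoeff q (k + 1) m = planeB q (planeCoeff q k m) := by
  rw [planeCoeff, pow_succ', Module.End.mul_apply, planeCoeff]

theorem planeCoeff_zero_succ (m : ℕ) :
    planeCoeff q 0 (m + 1) = planeA q (planeCoeff q 0 m) := by
  rw [planeCoeff, pow_succ', Module.End.mul_apply, planeCoeff]
  rfl

/-- With an arbitrary right factor, the quadratic relations act as rewriting rules on
right-associated words. They move γ* and γ to the left of α and α*, so that identities between
operators reduce to comparing scalars. -/
theorem mul_mul_of_eq_smul {A : Type} [Ring A] [Algebra ℂ A] {a b c d : A} {z : ℂ}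
    (h : a * b = z • (c * d)) (y : A) : a * (b * y) = z • (c * (d * y)) := by
  rw [← mul_assoc, h, smul_mul_assoc, mul_assoc]

theorem adj_α_mul_α_mul (y : OSU q) :
    star (α q) * (α q * y) = y - star (γ q) * (γ q * y) := by
  rw [← mul_assoc, adj_mul_α, sub_mul, one_mul, mul_assoc]

theorem α_mul_adj_α_mul (y : OSU q) :
    α q * (star (α q) * y) = y - qc q ^ 2 • (star (γ q) * (γ q * y)) := by
  rw [← mul_assoc, α_mul_adj, sub_mul, one_mul, smul_mul_assoc, mul_assoc]

theorem γ_mul_adj_γ_mul (y : OSU q) :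
    γ q * (star (γ q) * y) = star (γ q) * (γ q * y) := by
  rw [← mul_assoc, γ_mul_adj, mul_assoc]

/-- The relation ac = q ca is preserved by the coaction on the quantum plane. -/
theorem planeA_planeB (f : ℤ → OSU q) :
    planeA q (planeB q f) = qc q • planeB q (planeA q f) := by
  have hq := qc_ne_zero q
  ext j
  simp only [planeA_apply, planeB_apply, Pi.smul_apply, mul_add, mul_sub, mul_smul_comm,
    smul_add, smul_sub, smul_smul, adj_α_mul_α_mul, α_mul_adj_α_mul, γ_mul_adj_γ_mul,
    mul_mul_of_eq_smul (α_mul_γ q), mul_mul_of_eq_smul (adj_α_mul_γ q),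
    mul_mul_of_eq_smul (α_mul_adj_γ q), mul_mul_of_eq_smul (adj_α_mul_adj_γ q),
    zpow_sub_one₀ hq]
  match_scalars <;> (try field_simp) <;> ring

theorem planeA_planeCoeff (k m : ℕ) :
    planeA q (planeCoeff q k m) = qc q ^ k • planeCoeff q k (m + 1) := by
  induction k with
  | zero => rw [pow_zero, one_smul, planeCoeff_zero_succ]
  | succ k ih =>
    rw [planeCoeff_succ_left, planeA_planeB, ih, map_smul, ← planeCoeff_succ_left, smul_smul,
      pow_succ']

theorem planeCoeff_eq_zero (k m : ℕ) (j : ℤ) (hj : j < 0 ∨ (k + m : ℤ) < j) :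
    planeCoeff q k m j = 0 := by
  induction k generalizing j with
  | zero =>
    induction m generalizing j with
    | zero =>
      rw [planeCoeff_zero_zero, Pi.single_apply, if_neg]
      push_cast at hj
      omega
    | succ m ih =>
      push_cast at hj ih
      rw [planeCoeff_zero_succ, planeA_apply, ih j (by omega), ih (j - 1) (by omega)]
      simp
  | succ k ih =>
    push_cast at hj ih
    rw [planeCoeff_succ_left, planeB_apply, ih j (by omega), ih (j - 1) (by omega)]
    simp

/-! ### Lowering operators on the quantum plane -/

/-- The operator lowering the exponent of `γ ⊗ a + α^* ⊗ c`, on elements of degree `d`. -/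
def lowerB (d : ℤ) : (ℤ → OSU q) →ₗ[ℂ] (ℤ → OSU q) where
  toFun f k := qint q (k + 1) • (α q * f (k + 1)) +
    (qc q ^ (k + 2) * qint q (d - k)) • (star (γ q) * f k)
  map_add' f g := by
    ext j
    simp only [Pi.add_apply, mul_add, smul_add]
    abel
  map_smul' c f := by
    ext j
    simp only [Pi.smul_apply, mul_smul_comm, smul_add, RingHom.id_apply, smul_comm c]

/-- The operator lowering the exponent of `α ⊗ a - q γ^* ⊗ c`, on elements of degree `d`. -/
def lowerA (d : ℤ) : (ℤ → OSU q) →ₗ[ℂ] (ℤ → OSU q) where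
  toFun f k := qint q (k + 1) • (γ q * f (k + 1)) -
    (qc q ^ (k + 1) * qint q (d - k)) • (star (α q) * f k)
  map_add' f g := by
    ext j
    simp only [Pi.add_apply, mul_add, smul_add]
    abel
  map_smul' c f := by
    ext j
    simp only [Pi.smul_apply, mul_smul_comm, smul_sub, RingHom.id_apply, smul_comm c]

theorem lowerB_apply (d : ℤ) (f : ℤ → OSU q) (k : ℤ) :
    lowerB q d f k = qint q (k + 1) • (α q * f (k + 1)) +
      (qc q ^ (k + 2) * qint q (d - k)) • (star (γ q) * f k) := rfl

theorem lowerA_apply (d : ℤ) (f : ℤ → OSU q) (k : ℤ) :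
    lowerA q d f k = qint q (k + 1) • (γ q * f (k + 1)) -
      (qc q ^ (k + 1) * qint q (d - k)) • (star (α q) * f k) := rfl

/-- The operators `lowerB` and `lowerA` are the combinations appearing in the two blocks of rows of
(T⁽¹⁾ ⊗ T⁽ⁿ⁺¹⁾) D. Together with the next three lemmas this is a twisted Leibniz rule: each operator
q-commutes with multiplication by the other variable and picks up an inhomogeneous term from its
own. -/
theorem lowerB_planeB (d : ℤ) (f : ℤ → OSU q) :
    lowerB q (d + 1) (planeB q f) = f + qc q ^ 2 • planeB q (lowerB q d f) := by
  have hq := qc_ne_zero q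
  have h1 := one_sub_qc_sq_ne_zero q
  ext k
  simp only [lowerB_apply, planeB_apply, Pi.smul_apply, Pi.add_apply, mul_add, mul_sub,
    mul_smul_comm,
    smul_add, smul_sub, smul_smul, adj_α_mul_α_mul, α_mul_adj_α_mul, γ_mul_adj_γ_mul,
    mul_mul_of_eq_smul (α_mul_γ q), mul_mul_of_eq_smul (adj_α_mul_γ q),
    mul_mul_of_eq_smul (α_mul_adj_γ q), mul_mul_of_eq_smul (adj_α_mul_adj_γ q),
    add_sub_cancel_right, sub_add_cancel, qint, zpow_sub₀ hq, zpow_add₀ hq, zpow_mul, zpow_one,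
    zpow_ofNat, mul_comm (2 : ℤ)]
  match_scalars <;> (try field_simp) <;> ring

theorem lowerB_planeA (d : ℤ) (f : ℤ → OSU q) :
    lowerB q (d + 1) (planeA q f) = qc q • planeA q (lowerB q d f) := by
  have hq := qc_ne_zero q
  have h1 := one_sub_qc_sq_ne_zero q
  ext k
  simp only [lowerB_apply, planeA_apply, Pi.smul_apply, Pi.add_apply, mul_add, mul_sub,
    mul_smul_comm,
    smul_add, smul_sub, smul_smul, adj_α_mul_α_mul, α_mul_adj_α_mul, γ_mul_adj_γ_mul,
    mul_mul_of_eq_smul (α_mul_γ q), mul_mul_of_eq_smul (adj_α_mul_γ q),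
    mul_mul_of_eq_smul (α_mul_adj_γ q), mul_mul_of_eq_smul (adj_α_mul_adj_γ q),
    add_sub_cancel_right, sub_add_cancel, qint, zpow_sub₀ hq, zpow_add₀ hq, zpow_mul, zpow_one,
    zpow_ofNat, mul_comm (2 : ℤ)]
  match_scalars <;> (try field_simp) <;> ring

theorem lowerA_planeB (d : ℤ) (f : ℤ → OSU q) :
    lowerA q (d + 1) (planeB q f) = qc q • planeB q (lowerA q d f) := by
  have hq := qc_ne_zero q
  have h1 := one_sub_qc_sq_ne_zero q
  ext k
  simp only [lowerA_apply, planeB_apply, Pi.smul_apply, Pi.add_apply, mul_add, mul_sub,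
    mul_smul_comm,
    smul_add, smul_sub, smul_smul, adj_α_mul_α_mul, α_mul_adj_α_mul, γ_mul_adj_γ_mul,
    mul_mul_of_eq_smul (α_mul_γ q), mul_mul_of_eq_smul (adj_α_mul_γ q),
    mul_mul_of_eq_smul (α_mul_adj_γ q), mul_mul_of_eq_smul (adj_α_mul_adj_γ q),
    add_sub_cancel_right, sub_add_cancel, qint, zpow_sub₀ hq, zpow_add₀ hq, zpow_mul, zpow_one,
    zpow_ofNat, mul_comm (2 : ℤ)]
  match_scalars <;> (try field_simp) <;> ring

theorem lowerA_planeA (d : ℤ) (f : ℤ → OSU q) :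
    lowerA q (d + 1) (planeA q f) = planeA q (lowerA q d f) - qc q ^ (2 * d + 1) • f := by
  have hq := qc_ne_zero q
  have h1 := one_sub_qc_sq_ne_zero q
  ext k
  simp only [lowerA_apply, planeA_apply, Pi.smul_apply, Pi.add_apply, Pi.sub_apply, mul_add,
    mul_sub, mul_smul_comm,
    smul_add, smul_sub, smul_smul, adj_α_mul_α_mul, α_mul_adj_α_mul, γ_mul_adj_γ_mul,
    mul_mul_of_eq_smul (α_mul_γ q), mul_mul_of_eq_smul (adj_α_mul_γ q),
    mul_mul_of_eq_smul (α_mul_adj_γ q), mul_mul_of_eq_smul (adj_α_mul_adj_γ q),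
    add_sub_cancel_right, sub_add_cancel, qint, zpow_sub₀ hq, zpow_add₀ hq, zpow_mul, zpow_one,
    zpow_ofNat, mul_comm (2 : ℤ)]
  match_scalars <;> (try field_simp) <;> ring

/-! ### Action of the lowering operators on ordered monomials -/

theorem qint_zero : qint q 0 = 0 := by simp [qint]

theorem qint_succ (n : ℕ) : qint q (n + 1 : ℕ) = qint q n + qc q ^ (2 * n) := by
  have h1 := one_sub_qc_sq_ne_zero q
  have h2 : ∀ m : ℕ, qc q ^ (2 * (m : ℤ)) = qc q ^ (2 * m) := fun m => by
    rw [← zpow_natCast, Nat.cast_mul, Nat.cast_ofNat]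
  simp only [qint, h2]
  field_simp
  ring

theorem qint_succ' (n : ℕ) : qint q (n + 1 : ℕ) = 1 + qc q ^ 2 * qint q n := by
  have h1 := one_sub_qc_sq_ne_zero q
  have h2 : ∀ m : ℕ, qc q ^ (2 * (m : ℤ)) = qc q ^ (2 * m) := fun m => by
    rw [← zpow_natCast, Nat.cast_mul, Nat.cast_ofNat]
  simp only [qint, h2]
  field_simp
  ring

/-- The only coefficients that could survive, at k = -1 and k = 0, both carry the factor [0] = 0. -/
theorem lowerB_single : lowerB q 0 (Pi.single 0 1) = 0 := by
  ext k
  rw [lowerB_apply, Pi.zero_apply]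
  rcases eq_or_ne (k + 1) 0 with h | h
  · have : k ≠ 0 := by omega
    simp [h, this, qint_zero]
  · rcases eq_or_ne k 0 with rfl | h'
    · simp [qint_zero]
    · simp [h, h']

theorem lowerA_single : lowerA q 0 (Pi.single 0 1) = 0 := by
  ext k
  rw [lowerA_apply, Pi.zero_apply]
  rcases eq_or_ne (k + 1) 0 with h | h
  · have : k ≠ 0 := by omega
    simp [h, this, qint_zero]
  · rcases eq_or_ne k 0 with rfl | h'
    · simp [qint_zero]
    · simp [h, h']

theorem lowerB_planeCoeff_zero (m : ℕ) : lowerB q m (planeCoeff q 0 m) = 0 := by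
  induction m with
  | zero => exact lowerB_single q
  | succ m ih =>
    rw [planeCoeff_zero_succ, Nat.cast_succ, lowerB_planeA, ih, map_zero, smul_zero]

/-- The Leibniz rule is iterated over the factors B, starting from the fact that powers of A are
killed; the weights 1, q², …, q^{2k} add up to [k+1]. -/
theorem lowerB_planeCoeff (k m : ℕ) :
    lowerB q (k + 1 + m : ℕ) (planeCoeff q (k + 1) m) =
      qint q (k + 1 : ℕ) • planeCoeff q k m := by
  have e : ((k + 1 + m : ℕ) : ℤ) = (k + m : ℕ) + 1 := by push_cast; ring
  induction k with
  | zero =>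
    rw [planeCoeff_succ_left, e, lowerB_planeB, zero_add m, lowerB_planeCoeff_zero, qint_succ',
      Nat.cast_zero, qint_zero]
    simp
  | succ k ih =>
    rw [planeCoeff_succ_left, e, lowerB_planeB, ih (by push_cast; ring), map_smul,
      ← planeCoeff_succ_left, qint_succ' q (k + 1), add_smul, one_smul, mul_smul]

/-- Peeling off the factors A one at a time contributes -q^{2d+1} for d = 0, …, m, and these sum to
-q[m+1]. -/
theorem lowerA_planeCoeff_zero (m : ℕ) : lowerA q (m + 1 : ℕ) (planeCoeff q 0 (m + 1)) =
    -(qc q * qint q (m + 1 : ℕ)) • planeCoeff q 0 m := by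
  induction m with
  | zero =>
    have := lowerA_planeA q 0 (Pi.single 0 1)
    rw [lowerA_single, map_zero, mul_zero, zero_add] at this
    rw [planeCoeff_zero_succ, planeCoeff_zero_zero, qint_succ, Nat.cast_succ, Nat.cast_zero,
      zero_add, this, qint_zero]
    simp
  | succ m ih =>
    rw [planeCoeff_zero_succ, Nat.cast_succ, lowerA_planeA, ih, map_smul, ← planeCoeff_zero_succ,
      ← Nat.cast_succ, Nat.succ_eq_add_one, qint_succ q (m + 1), ← sub_smul]
    congr 1
    have : qc q ^ (2 * ((m + 1 : ℕ) : ℤ) + 1) = qc q ^ (2 * (m + 1) + 1) := by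
      rw [← zpow_natCast]; push_cast; rfl
    rw [this]
    ring

theorem lowerA_planeCoeff (k m : ℕ) :
    lowerA q (k + (m + 1) : ℕ) (planeCoeff q k (m + 1)) =
      -(qc q ^ (k + 1) * qint q (m + 1 : ℕ)) • planeCoeff q k m := by
  induction k with
  | zero => rw [zero_add, zero_add, pow_one, lowerA_planeCoeff_zero]
  | succ k ih =>
    have e : ((k + 1 + (m + 1) : ℕ) : ℤ) = (k + (m + 1) : ℕ) + 1 := by push_cast; ring
    rw [planeCoeff_succ_left, e, lowerA_planeB, ih, map_smul, ← planeCoeff_succ_left, smul_smul]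
    congr 1
    ring

theorem lowerA_planeCoeff_zero_right (k : ℕ) : lowerA q k (planeCoeff q k 0) = 0 := by
  induction k with
  | zero => exact lowerA_single q
  | succ k ih =>
    rw [planeCoeff_succ_left, Nat.cast_succ, lowerA_planeB, ih, map_zero, smul_zero]

end Plane

/-! ### The matrix entries of `T⁽ⁿ⁾` as coefficients in the quantum plane -/

section Coefficients

variable (q : Set.Ioo (0 : ℝ) 1)

theorem planeA_single (i : ℤ) (y : OSU q) :
    planeA q (Pi.single i y) =
      Pi.single i (qc q ^ i • (α q * y)) - Pi.single (i + 1) (qc q • (star (γ q) * y)) := by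
  ext j
  have e : j - 1 = i ↔ j = i + 1 := sub_eq_iff_eq_add
  simp only [planeA_apply, Pi.sub_apply, Pi.single_apply, e, mul_ite, mul_zero, smul_ite,
    smul_zero]
  congr 1
  split_ifs with h
  · rw [h]
  · rfl

theorem planeB_single (i : ℤ) (y : OSU q) :
    planeB q (Pi.single i y) =
      Pi.single i (qc q ^ i • (γ q * y)) + Pi.single (i + 1) (star (α q) * y) := by
  ext j
  simp only [planeB_apply, Pi.add_apply, Pi.single_apply, sub_eq_iff_eq_add, mul_ite, mul_zero,
    smul_ite, smul_zero]
  congr 1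
  split_ifs with h
  · rw [h]
  · rfl

theorem mul_pow_of_eq_smul {A : Type} [Ring A] [Algebra ℂ A] {a b : A} {z : ℂ}
    (h : a * b = z • (b * a)) (s : ℕ) : a * b ^ s = z ^ s • (b ^ s * a) := by
  induction s with
  | zero => simp
  | succ s ih =>
    rw [pow_succ, ← mul_assoc, ih, smul_mul_assoc, mul_assoc, h, mul_smul_comm, smul_smul,
      ← pow_succ, mul_assoc]

theorem γ_mul_adj_α (q : Set.Ioo (0 : ℝ) 1) : γ q * star (α q) = qc q • (star (α q) * γ q) := by
  rw [adj_α_mul_γ, smul_smul, mul_inv_cancel₀ (qc_ne_zero q), one_smul]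

/-- This is the q-binomial theorem for A^m. Moving α past (γ*)^s and a past c^s gives q^s each; the
resulting q^{2s} is the weight in the q-Pascal rule. -/
theorem planeCoeff_zero_eq_sum (m : ℕ) : planeCoeff q 0 m =
    ∑ s ∈ Finset.range (m + 1), (qbinom q m s : ℂ) •
      Pi.single (s : ℤ) ((-qc q) ^ s • (star (γ q) ^ s * α q ^ (m - s))) := by
  induction m with
  | zero => simp [planeCoeff_zero_zero, qbinom_zero]
  | succ m ih =>
    rw [planeCoeff_zero_succ, ih, map_sum, ← sum_qbinom_succ]
    refine Finset.sum_congr rfl fun s hs => ?_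
    have hs' : m + 1 - s = m - s + 1 := by have := Finset.mem_range.1 hs; omega
    have hs'' : m + 1 - (s + 1) = m - s := by omega
    rw [map_smul, planeA_single, hs', hs'', sub_eq_add_neg, ← Pi.single_neg, ← Pi.single_smul,
      Nat.cast_succ, mul_smul_comm, mul_smul_comm, ← mul_assoc, ← mul_assoc,
      mul_pow_of_eq_smul (α_mul_adj_γ q), smul_mul_assoc, mul_assoc, ← pow_succ', ← pow_succ']
    simp only [smul_smul, zpow_natCast]
    congr 3
    · congr 1; ring
    · rw [pow_succ (-qc q), ← neg_smul]; congr 1; ring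

/-- The same argument for multiplication by B: γ passing (α*)^r gives q^r and a passing c^{r+s}
gives q^{r+s}. The factor q^{2r} is the Pascal weight, and the remaining q^s raises the exponent
s(k-r) to s(k+1-r). -/
theorem planeCoeff_eq_sum (k m : ℕ) : planeCoeff q k m =
    ∑ s ∈ Finset.range (m + 1), ∑ r ∈ Finset.range (k + 1), (qbinom q k r : ℂ) •
      Pi.single ((r + s : ℕ) : ℤ)
        (((qbinom q m s : ℂ) * (-qc q) ^ s * qc q ^ (s * (k - r))) •
          (star (α q) ^ r * γ q ^ (k - r) * star (γ q) ^ s * α q ^ (m - s))) := by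
  induction k with
  | zero =>
    rw [planeCoeff_zero_eq_sum]
    refine Finset.sum_congr rfl fun s _ => ?_
    simp [qbinom_zero, ← Pi.single_smul, smul_smul]
  | succ k ih =>
    rw [planeCoeff_succ_left, ih, map_sum]
    refine Finset.sum_congr rfl fun s _ => ?_
    rw [map_sum, ← sum_qbinom_succ]
    refine Finset.sum_congr rfl fun r hr => ?_
    have hr' : k + 1 - r = k - r + 1 := by have := Finset.mem_range.1 hr; omega
    have hr'' : k + 1 - (r + 1) = k - r := by omega
    have e : ((r + s : ℕ) : ℤ) + 1 = (r + 1 + s : ℕ) := by push_cast; ring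
    rw [map_smul, planeB_single, hr', hr'', ← Pi.single_smul, e, mul_smul_comm, mul_smul_comm,
      ← mul_assoc, ← mul_assoc, ← mul_assoc, ← mul_assoc, ← mul_assoc, ← mul_assoc,
      mul_pow_of_eq_smul (γ_mul_adj_α q), smul_mul_assoc, smul_mul_assoc, smul_mul_assoc,
      mul_assoc (star (α q) ^ r), ← pow_succ', ← pow_succ']
    simp only [smul_smul, zpow_natCast]
    congr 4
    ring

theorem T_eq_planeCoeff (n : ℕ) (k j : Fin (n + 1)) : T q n k j =
    (sqrtFact q j * sqrtFact q (n - j) / (sqrtFact q k * sqrtFact q (n - k))) •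
      planeCoeff q k (n - k) j := by
  have h0 := sqrtFact_ne_zero q n
  have h1 := sqrtFact_ne_zero q k
  have h2 := sqrtFact_ne_zero q (n - k)
  have h3 := sqrtFact_ne_zero q j
  have h4 := sqrtFact_ne_zero q (n - j)
  rw [T, csqrt_qbinom q (by omega), csqrt_qbinom q (by omega)]
  congr 1
  · field_simp
  · rw [planeCoeff_eq_sum, Finset.sum_apply, Finset.sum_comm]
    refine Finset.sum_congr rfl fun s _ => ?_
    rw [Finset.sum_apply]
    refine Finset.sum_congr rfl fun r _ => ?_
    rw [Pi.smul_apply, Pi.single_apply]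
    by_cases h : r + s = (j : ℕ)
    · rw [if_pos h, if_pos (by rw [h]), smul_smul]
      congr 1
      ring
    · rw [if_neg h, if_neg (by omega), smul_zero]

/-- The conjugate of the corepresentation `T⁽ⁿ⁾` is equivalent to `T⁽ⁿ⁾`. -/
theorem star_T (n : ℕ) (k j : Fin (n + 1)) :
    star (T q n k j) = ((-qc q) ^ (j : ℕ) * ((-qc q) ^ (k : ℕ))⁻¹) • T q n k.rev j.rev := by
  have hq : -qc q ≠ 0 := neg_ne_zero.2 (qc_ne_zero q)
  have hk : n - (k.rev : ℕ) = k := by rw [Fin.val_rev]; omega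
  have hk' : (k.rev : ℕ) = n - k := by rw [Fin.val_rev]; omega
  have hj' : (j.rev : ℕ) = n - j := by rw [Fin.val_rev]; omega
  have hc : ∀ r, star ((qbinom q k r : ℂ)) = qbinom q k r := fun r => Complex.conj_ofReal _
  have hc' : ∀ s, star ((qbinom q (n - k) s : ℂ)) = qbinom q (n - k) s :=
    fun r => Complex.conj_ofReal _
  rw [T, T, hk, hk', hj', qbinom_symm q (by omega), qbinom_symm q (by omega), star_smul, star_div₀,
    star_csqrt, star_csqrt, smul_comm _ (csqrt _ / csqrt _)]
  congr 1
  simp only [star_sum]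
  -- The adjoint of the monomial indexed by (r, s) is, without any reordering, the monomial of row n
  -- - k indexed by (n - k - s, k - r). Hence the two sums are exchanged and both are reversed; only
  -- powers of -q remain to be compared.
  rw [Finset.sum_comm, Finset.smul_sum]
  conv_rhs => rw [← Finset.sum_range_reflect]
  refine Finset.sum_congr rfl fun s hs => ?_
  rw [Finset.smul_sum]
  conv_rhs => rw [← Finset.sum_range_reflect]
  refine Finset.sum_congr rfl fun r hr => ?_
  have hs' := Finset.mem_range.1 hs
  have hr' := Finset.mem_range.1 hr
  by_cases h : r + s = (j : ℕ)
  · obtain ⟨a, ha⟩ := Nat.exists_eq_add_of_le (Nat.lt_succ_iff.1 hr')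
    obtain ⟨b, hb⟩ := Nat.exists_eq_add_of_le (Nat.lt_succ_iff.1 hs')
    have e1 : n - k + 1 - 1 - s = n - k - s := by omega
    have e2 : (k : ℕ) + 1 - 1 - r = k - r := by omega
    have e3 : n - k - (n - k - s) = s := by omega
    have e4 : (k : ℕ) - (k - r) = r := by omega
    rw [if_pos h, e1, e2, if_pos (by omega), qbinom_symm q (by omega), qbinom_symm q (by omega),
      e3, e4, star_smul]
    simp only [star_mul, star_pow, star_star, hc, hc', star_neg, star_qc, smul_smul, mul_assoc]
    congr 1
    have e5 : (k : ℕ) - r = a := by omega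
    rw [e5, ← h, ha, pow_add, pow_add]
    field_simp
    ring
  · rw [if_neg h, if_neg (by omega), star_zero, smul_zero]

end Coefficients

/-! ### Clebsch–Gordan matrices -/

section ClebschGordan

variable (q : Set.Ioo (0 : ℝ) 1)

/-- The isometry intertwining `T⁽ⁿ⁺¹⁾` with the tensor product of `T⁽¹⁾` and `T⁽ⁿ⁾`. -/
def raiseCG (n : ℕ) : Matrix (Fin 2 × Fin (n + 1)) (Fin (n + 2)) ℂ :=
  fun p k => (csqrt (qnum q (n + 1)))⁻¹ *
    if p.1 = 0 then
      if k = p.2.castSucc then qc q ^ (k : ℕ) * csqrt (qnum q (n + 1 - (k : ℕ))) else 0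
    else if k = p.2.succ then csqrt (qnum q k) else 0

/-- The isometry intertwining `T⁽ⁿ⁾` with the tensor product of `T⁽¹⁾` and `T⁽ⁿ⁺¹⁾`. -/
def lowerCG (n : ℕ) : Matrix (Fin 2 × Fin (n + 2)) (Fin (n + 1)) ℂ :=
  fun p k => (csqrt (qnum q (n + 2)))⁻¹ *
    if p.1 = 0 then if p.2 = k.succ then csqrt (qnum q ((k : ℕ) + 1)) else 0
    else if p.2 = k.castSucc then -(qc q ^ ((k : ℕ) + 1) * csqrt (qnum q (n + 1 - (k : ℕ)))) else 0

theorem star_raiseCG (n : ℕ) (p : Fin 2 × Fin (n + 1)) (k : Fin (n + 2)) :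
    star (raiseCG q n p k) = raiseCG q n p k := by
  unfold raiseCG
  split_ifs <;> simp only [star_mul', star_inv₀, star_pow, star_csqrt, star_qc, star_zero]

theorem star_lowerCG (n : ℕ) (p : Fin 2 × Fin (n + 2)) (k : Fin (n + 1)) :
    star (lowerCG q n p k) = lowerCG q n p k := by
  unfold lowerCG
  split_ifs <;> simp only [star_mul', star_neg, star_inv₀, star_pow, star_csqrt, star_qc, star_zero]

/-! ### Rows and columns of the Clebsch–Gordan matrices -/

section Sums

variable {M : Type*} [AddCommGroup M]

theorem sum_ite_castSucc {n : ℕ} (g : Fin n → M) (k : Fin (n + 1)) :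
    ∑ l : Fin n, (if k = l.castSucc then g l else 0) =
      Fin.snoc (α := fun _ => M) g 0 k := by
  induction k using Fin.lastCases with
  | last => simp [Fin.snoc_last, (Fin.castSucc_lt_last _).ne']
  | cast k => simp

theorem sum_ite_succ {n : ℕ} (g : Fin n → M) (k : Fin (n + 1)) :
    ∑ l : Fin n, (if k = l.succ then g l else 0) =
      Fin.cons (α := fun _ => M) 0 g k := by
  induction k using Fin.cases with
  | zero => simp [(Fin.succ_ne_zero _).symm]
  | succ k => simp

variable [Module ℂ M]

theorem sum_raiseCG_col (n : ℕ) (g : Fin 2 × Fin (n + 1) → M) (k : Fin (n + 2)) :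
    ∑ p, raiseCG q n p k • g p = (csqrt (qnum q (n + 1)))⁻¹ •
      ((qc q ^ (k : ℕ) * csqrt (qnum q (n + 1 - (k : ℕ)))) •
          Fin.snoc (α := fun _ => M) (fun l => g (0, l)) 0 k +
        csqrt (qnum q k) • Fin.cons (α := fun _ => M) 0 (fun l => g (1, l)) k) := by
  rw [← sum_ite_castSucc, ← sum_ite_succ, Fintype.sum_prod_type, Fin.sum_univ_two, smul_add]
  simp only [Finset.smul_sum, smul_ite, smul_zero, raiseCG, mul_smul, ite_smul, zero_smul,
    if_true, one_ne_zero, if_false]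

theorem sum_raiseCG_row_zero (n : ℕ) (g : Fin (n + 2) → M) (l : Fin (n + 1)) :
    ∑ k, raiseCG q n (0, l) k • g k = (csqrt (qnum q (n + 1)))⁻¹ •
      (qc q ^ (l : ℕ) * csqrt (qnum q (n + 1 - (l : ℕ)))) • g l.castSucc := by
  simp only [raiseCG, mul_smul, ite_smul, zero_smul, if_true, smul_ite, smul_zero,
    Finset.sum_ite_eq', Finset.mem_univ, Fin.val_castSucc]

theorem sum_raiseCG_row_one (n : ℕ) (g : Fin (n + 2) → M) (l : Fin (n + 1)) :
    ∑ k, raiseCG q n (1, l) k • g k = (csqrt (qnum q (n + 1)))⁻¹ •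
      csqrt (qnum q ((l : ℕ) + 1)) • g l.succ := by
  simp only [raiseCG, mul_smul, ite_smul, zero_smul, one_ne_zero, if_false, smul_ite, smul_zero,
    Finset.sum_ite_eq', Finset.mem_univ, Fin.val_succ, if_true]

theorem sum_lowerCG_col (n : ℕ) (g : Fin 2 × Fin (n + 2) → M) (k : Fin (n + 1)) :
    ∑ p, lowerCG q n p k • g p = (csqrt (qnum q (n + 2)))⁻¹ •
      (csqrt (qnum q ((k : ℕ) + 1)) • g (0, k.succ) -
        (qc q ^ ((k : ℕ) + 1) * csqrt (qnum q (n + 1 - (k : ℕ)))) • g (1, k.castSucc)) := by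
  rw [Fintype.sum_prod_type, Fin.sum_univ_two]
  simp only [lowerCG, mul_smul, ite_smul, zero_smul, one_ne_zero, if_false, smul_ite, smul_zero,
    Finset.sum_ite_eq', Finset.mem_univ, if_true, neg_smul, smul_add, smul_neg, sub_eq_add_neg,
    Finset.sum_ite_eq]

theorem sum_lowerCG_row_zero (n : ℕ) (g : Fin (n + 1) → M) (l : Fin (n + 2)) :
    ∑ k, lowerCG q n (0, l) k • g k = (csqrt (qnum q (n + 2)))⁻¹ •
      csqrt (qnum q l) • Fin.cons (α := fun _ => M) 0 g l := by
  rw [← sum_ite_succ]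
  simp only [lowerCG, mul_smul, ite_smul, zero_smul, if_true, smul_ite, smul_zero,
    Finset.smul_sum]
  refine Finset.sum_congr rfl fun k _ => ?_
  split_ifs with h
  · rw [h, Fin.val_succ]
  · rfl

theorem sum_lowerCG_row_one (n : ℕ) (g : Fin (n + 1) → M) (l : Fin (n + 2)) :
    ∑ k, lowerCG q n (1, l) k • g k = (csqrt (qnum q (n + 2)))⁻¹ •
      -(qc q ^ ((l : ℕ) + 1) * csqrt (qnum q (n + 1 - (l : ℕ)))) •
        Fin.snoc (α := fun _ => M) g 0 l := by
  rw [← sum_ite_castSucc]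
  simp only [lowerCG, mul_smul, ite_smul, zero_smul, one_ne_zero, if_false, smul_ite, smul_zero,
    Finset.smul_sum, neg_smul, smul_neg]
  refine Finset.sum_congr rfl fun k _ => ?_
  split_ifs with h
  · rw [h, Fin.val_castSucc]
  · rfl

end Sums

/-! ### Orthonormality and completeness of the Clebsch–Gordan matrices -/

theorem qnum_split {n k : ℕ} (h : k ≤ n) :
    qc q ^ (2 * k) * (qnum q (n - k) : ℂ) + qnum q k = qnum q n := by
  obtain ⟨m, rfl⟩ := Nat.exists_eq_add_of_le h
  rw [Nat.add_sub_cancel_left, qnum_add]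
  push_cast [qc]
  ring

theorem raiseCG_isometry (n : ℕ) : (raiseCG q n)ᴴ * raiseCG q n = 1 := by
  ext k k'
  have hn := csqrt_qnum_succ_ne_zero q n
  -- The square root vanishes at the padded column, so the diagonal formula holds there too; `h2`
  -- treats the other end likewise.
  have h1 : (csqrt (qnum q (n + 1 - (k : ℕ)))) •
      Fin.snoc (α := fun _ => ℂ) (fun l => raiseCG q n (0, l) k') 0 k =
      if k = k' then (csqrt (qnum q (n + 1)))⁻¹ * (qc q ^ (k : ℕ) * qnum q (n + 1 - (k : ℕ)))
      else 0 := by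
    rw [← csqrt_qnum_mul_self]
    induction k using Fin.lastCases with
    | last => simp [csqrt_qnum_zero]
    | cast k =>
      rw [Fin.snoc_castSucc]
      simp only [raiseCG, if_true, eq_comm (a := k')]
      split_ifs with h
      · rw [← h, smul_eq_mul]; ring
      · simp
  have h2 : csqrt (qnum q k) • Fin.cons (α := fun _ => ℂ) 0 (fun l => raiseCG q n (1, l) k') k =
      if k = k' then (csqrt (qnum q (n + 1)))⁻¹ * qnum q k else 0 := by
    rw [← csqrt_qnum_mul_self]
    induction k using Fin.cases with
    | zero => simp [csqrt_qnum_zero]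
    | succ k =>
      rw [Fin.cons_succ]
      simp only [raiseCG, one_ne_zero, if_false, eq_comm (a := k')]
      split_ifs with h
      · rw [← h, smul_eq_mul]; ring
      · simp
  have h3 : ((raiseCG q n)ᴴ * raiseCG q n) k k' = ∑ p, raiseCG q n p k • raiseCG q n p k' := by
    simp only [Matrix.mul_apply, Matrix.conjTranspose_apply, star_raiseCG, smul_eq_mul]
  rw [h3, sum_raiseCG_col, mul_smul, h1, h2, Matrix.one_apply]
  split_ifs with h
  · have h4 := qnum_split q (Nat.lt_succ_iff.1 k.2)
    rw [← csqrt_qnum_mul_self q (n + 1)] at h4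
    rw [smul_eq_mul, smul_eq_mul, inv_mul_eq_iff_eq_mul₀ hn, mul_one, mul_left_comm, ← mul_add,
      inv_mul_eq_iff_eq_mul₀ hn, ← h4]
    ring
  · simp

theorem lowerCG_isometry (n : ℕ) : (lowerCG q n)ᴴ * lowerCG q n = 1 := by
  ext k k'
  have hn := csqrt_qnum_succ_ne_zero q (n + 1)
  have h3 : ((lowerCG q n)ᴴ * lowerCG q n) k k' = ∑ p, lowerCG q n p k • lowerCG q n p k' := by
    simp only [Matrix.mul_apply, Matrix.conjTranspose_apply, star_lowerCG, smul_eq_mul]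
  rw [h3, sum_lowerCG_col, Matrix.one_apply]
  simp only [lowerCG, if_true, one_ne_zero, if_false, Fin.succ_inj, Fin.castSucc_inj]
  split_ifs with h
  · have h4 := qnum_split q (show (k : ℕ) + 1 ≤ n + 1 + 1 by omega)
    rw [← csqrt_qnum_mul_self q (n + 1 + 1), ← csqrt_qnum_mul_self q ((k : ℕ) + 1),
      ← csqrt_qnum_mul_self q (n + 1 + 1 - _), Nat.add_sub_add_right] at h4
    subst h
    simp only [smul_eq_mul]
    rw [inv_mul_eq_iff_eq_mul₀ hn]
    field_simp
    rw [pow_two (csqrt (qnum q (n + 2))), ← h4]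
    ring
  · simp

/-- Only column k + 1 of the second factor meets column k of the first, and its two products q^{k+1}
[k+1]^{1/2} [n+1-k]^{1/2} occur with opposite signs. -/
theorem lowerCG_raiseCG (n : ℕ) : (lowerCG q n)ᴴ * raiseCG q (n + 1) = 0 := by
  ext k k'
  have h3 : ((lowerCG q n)ᴴ * raiseCG q (n + 1)) k k' =
      ∑ p, lowerCG q n p k • raiseCG q (n + 1) p k' := by
    simp only [Matrix.mul_apply, Matrix.conjTranspose_apply, star_lowerCG, smul_eq_mul]
  rw [h3, sum_lowerCG_col, Matrix.zero_apply]
  simp only [raiseCG, if_true, one_ne_zero, if_false, Fin.succ_castSucc]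
  split_ifs with h
  · rw [h]
    simp only [smul_eq_mul, Fin.val_castSucc, Fin.val_succ]
    rw [Nat.succ_sub_succ]
    ring
  · simp

/-- The block matrix (C D) has orthonormal columns and is square because 2(n+2) = (n+3) + (n+1). Its
left inverse is therefore also a right inverse. -/
theorem raiseCG_add_lowerCG (n : ℕ) :
    raiseCG q (n + 1) * (raiseCG q (n + 1))ᴴ + lowerCG q n * (lowerCG q n)ᴴ = 1 := by
  have h := congrArg Matrix.conjTranspose (lowerCG_raiseCG q n)
  rw [Matrix.conjTranspose_mul, Matrix.conjTranspose_conjTranspose, Matrix.conjTranspose_zero] at h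
  have h1 : Matrix.fromRows (raiseCG q (n + 1))ᴴ (lowerCG q n)ᴴ *
      Matrix.fromCols (raiseCG q (n + 1)) (lowerCG q n) = 1 := by
    rw [Matrix.fromRows_mul_fromCols, raiseCG_isometry, lowerCG_isometry, lowerCG_raiseCG, h,
      Matrix.fromBlocks_one]
  rw [Matrix.mul_eq_one_comm_of_card_eq, Matrix.fromCols_mul_fromRows] at h1
  · exact h1
  · simp
    ring

/-! ### Scalar matrices over an algebra -/

/-- A complex matrix, as a matrix over a complex algebra. -/
abbrev scalarMat (R : Type) [Ring R] [Algebra ℂ R] {ι κ : Type} (M : Matrix ι κ ℂ) :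
    Matrix ι κ R := M.map (algebraMap ℂ R)

section ScalarMat

variable {R : Type} [Ring R] [Algebra ℂ R] {ι κ μ : Type}

theorem scalarMat_mul [Fintype κ] (M : Matrix ι κ ℂ) (N : Matrix κ μ ℂ) :
    scalarMat R (M * N) = scalarMat R M * scalarMat R N :=
  Matrix.map_mul

theorem scalarMat_one [DecidableEq ι] : scalarMat R (1 : Matrix ι ι ℂ) = 1 :=
  Matrix.map_one _ (map_zero _) (map_one _)

theorem scalarMat_conjTranspose [StarRing R] [StarModule ℂ R] (M : Matrix ι κ ℂ) :
    (scalarMat R M)ᴴ = scalarMat R Mᴴ := by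
  ext i j
  exact (algebraMap_star_comm _).symm

theorem mul_scalarMat_apply [Fintype κ] (M : Matrix ι κ R) (N : Matrix κ μ ℂ) (i : ι) (k : μ) :
    (M * scalarMat R N) i k = ∑ p, N p k • M i p := by
  simp only [Matrix.mul_apply, Matrix.map_apply, Algebra.smul_def, Algebra.commutes]

theorem scalarMat_mul_apply [Fintype κ] (M : Matrix κ μ R) (N : Matrix ι κ ℂ) (i : ι) (k : μ) :
    (scalarMat R N * M) i k = ∑ p, N i p • M p k := by
  simp only [Matrix.mul_apply, Matrix.map_apply, Algebra.smul_def]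

end ScalarMat

/-! ### The intertwining relations -/

open scoped Kronecker

/-- The square root completes the q-factorial of n - k to that of n + 1 - k. The formula extends to
the padded last column because a monomial of degree n has no coefficient at n + 1. -/
theorem smul_snoc_T (n : ℕ) (y : OSU q) (l : Fin (n + 1)) (k : Fin (n + 2)) :
    csqrt (qnum q (n + 1 - (k : ℕ))) • Fin.snoc (α := fun _ => OSU q) (fun j => y * T q n l j) 0 k =
      (sqrtFact q k * sqrtFact q (n + 1 - k) / (sqrtFact q l * sqrtFact q (n - l))) •
        (y * planeCoeff q l (n - l) k) := by
  induction k using Fin.lastCases with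
  | last =>
    rw [Fin.snoc_last, planeCoeff_eq_zero q _ _ _ (by right; rw [Fin.val_last]; omega)]
    simp
  | cast k =>
    have : n + 1 - (k : ℕ) = n - k + 1 := by omega
    rw [Fin.snoc_castSucc, T_eq_planeCoeff, Fin.val_castSucc, this, sqrtFact, mul_smul_comm,
      smul_smul]
    congr 1
    ring

theorem smul_cons_T (n : ℕ) (y : OSU q) (l : Fin (n + 1)) (k : Fin (n + 2)) :
    csqrt (qnum q k) • Fin.cons (α := fun _ => OSU q) 0 (fun j => y * T q n l j) k =
      (sqrtFact q k * sqrtFact q (n + 1 - k) / (sqrtFact q l * sqrtFact q (n - l))) •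
        (y * planeCoeff q l (n - l) ((k : ℤ) - 1)) := by
  induction k using Fin.cases with
  | zero =>
    rw [Fin.cons_zero, planeCoeff_eq_zero q _ _ _ (by left; simp)]
    simp
  | succ k =>
    rw [Fin.cons_succ, T_eq_planeCoeff, Fin.val_succ, Nat.succ_sub_succ, sqrtFact, mul_smul_comm,
      smul_smul]
    congr 1
    · ring
    · simp

/-- Rows (0, l) and (1, l) express A B^l A^{n-l} = q^l B^l A^{n+1-l} and B · B^l A^{n-l} = B^{l+1}
A^{n-l}; the factor q^l is the one built into `raiseCG`. -/
theorem kronecker_T_mul_raiseCG (n : ℕ) :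
    (fundamental q ⊗ₖ T q n) * scalarMat (OSU q) (raiseCG q n) =
      scalarMat (OSU q) (raiseCG q n) * T q (n + 1) := by
  ext ⟨b, l⟩ k
  have hl := sqrtFact_ne_zero q l
  have hl' := sqrtFact_ne_zero q (n - l)
  have hs := csqrt_qnum_succ_ne_zero q (n - l)
  have hs' := csqrt_qnum_succ_ne_zero q l
  rw [mul_scalarMat_apply, scalarMat_mul_apply, sum_raiseCG_col]
  simp only [Matrix.kroneckerMap_apply]
  rw [mul_smul, smul_snoc_T, smul_cons_T, smul_comm (qc q ^ (k : ℕ)), ← smul_add]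
  fin_cases b
  · have h := congrFun (planeA_planeCoeff q l (n - l)) k
    have e : n + 1 - (l : ℕ) = n - l + 1 := by omega
    simp only [Fin.zero_eta, sum_raiseCG_row_zero, T_eq_planeCoeff, Fin.val_castSucc, e, sqrtFact]
    simp only [planeA_apply, zpow_natCast, Pi.smul_apply] at h
    simp only [fundamental, Matrix.of_apply, Matrix.cons_val_zero, Matrix.cons_val_one,
      Matrix.cons_val', Matrix.cons_val_fin_one, neg_mul, smul_mul_assoc, ← sub_eq_add_neg, h,
      smul_smul]
    congr 1
    field_simp
  · have h := congrFun (planeCoeff_succ_left q l (n - l)) k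
    simp only [Fin.mk_one, sum_raiseCG_row_one, T_eq_planeCoeff, Fin.val_succ, Nat.succ_sub_succ,
      sqrtFact]
    simp only [planeB_apply, zpow_natCast] at h
    simp only [fundamental, Matrix.of_apply, Matrix.cons_val_zero, Matrix.cons_val_one,
      Matrix.cons_val', Matrix.cons_val_fin_one, ← h, smul_smul]
    congr 1
    field_simp

theorem kronecker_T_mul_lowerCG (n : ℕ) :
    (fundamental q ⊗ₖ T q (n + 1)) * scalarMat (OSU q) (lowerCG q n) =
      scalarMat (OSU q) (lowerCG q n) * T q n := by
  ext ⟨b, l⟩ k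
  have hl := sqrtFact_ne_zero q l
  have hl' := sqrtFact_ne_zero q (n + 1 - l)
  have e0 : n + 1 - (k : ℕ) = n - k + 1 := by omega
  have q0 : qint q ((k : ℤ) + 1) = qnum q (k + 1) := qint_natCast q (k + 1)
  have q1 : qint q ((n + 1 : ℕ) - (k : ℤ)) = qnum q (n - k + 1) := by
    rw [← qint_natCast]
    congr 1
    omega
  have p0 : qc q ^ ((k : ℤ) + 1) = qc q ^ ((k : ℕ) + 1) := zpow_natCast _ (k + 1)
  have p1 : qc q ^ ((k : ℤ) + 2) = qc q ^ ((k : ℕ) + 2) := zpow_natCast _ (k + 2)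
  have hk := csqrt_qnum_mul_self q (k + 1)
  have hk' := csqrt_qnum_mul_self q (n - k + 1)
  rw [mul_scalarMat_apply, scalarMat_mul_apply, sum_lowerCG_col]
  simp only [Matrix.kroneckerMap_apply]
  fin_cases b
  · simp only [Fin.zero_eta, sum_lowerCG_row_zero]
    congr 1
    -- For b = 0 the entries α and -q γ* of the fundamental matrix assemble `lowerB` in degree n +
    -- 1; for b = 1 the entries γ and α* assemble `lowerA`.
    trans (sqrtFact q k * sqrtFact q (n - k) / (sqrtFact q l * sqrtFact q (n + 1 - l))) •
      lowerB q (n + 1 : ℕ) (planeCoeff q l (n + 1 - l)) k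
    · rw [lowerB_apply, q0, q1, p1, ← hk, ← hk']
      simp only [T_eq_planeCoeff, Fin.val_castSucc, Fin.val_succ, Nat.succ_sub_succ, sqrtFact, e0,
        fundamental, Matrix.of_apply, Matrix.cons_val_zero, Matrix.cons_val_one,
        Matrix.cons_val', Matrix.cons_val_fin_one, neg_mul, smul_mul_assoc, mul_smul_comm,
        smul_neg, sub_neg_eq_add, smul_add, smul_smul]
      congr 2
      · field_simp
      · field_simp
        ring
    -- At l = 0 there is no factor B to lower, which matches the zero padding; for b = 1 the same
    -- occurs at l = n + 1, where there is no factor A.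
    · induction l using Fin.cases with
      | zero =>
        simp only [Fin.val_zero, Nat.sub_zero, lowerB_planeCoeff_zero q (n + 1), Pi.zero_apply,
          smul_zero, Fin.cons_zero]
      | succ l =>
        have h := lowerB_planeCoeff q l (n - l)
        have e : ((l : ℕ) + 1 + (n - l)) = n + 1 := by omega
        have hs := csqrt_qnum_succ_ne_zero q l
        rw [e] at h
        rw [Fin.cons_succ, T_eq_planeCoeff, Fin.val_succ, Nat.succ_sub_succ, h, Pi.smul_apply,
          qint_natCast, ← csqrt_qnum_mul_self, sqrtFact, smul_smul, smul_smul]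
        rw [Fin.val_succ, sqrtFact] at hl
        congr 1
        field_simp
  · simp only [Fin.mk_one, sum_lowerCG_row_one]
    congr 1
    trans (sqrtFact q k * sqrtFact q (n - k) / (sqrtFact q l * sqrtFact q (n + 1 - l))) •
      lowerA q (n + 1 : ℕ) (planeCoeff q l (n + 1 - l)) k
    · rw [lowerA_apply, q0, q1, p0, ← hk, ← hk']
      simp only [T_eq_planeCoeff, Fin.val_castSucc, Fin.val_succ, Nat.succ_sub_succ, sqrtFact, e0,
        fundamental, Matrix.of_apply, Matrix.cons_val_zero, Matrix.cons_val_one,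
        Matrix.cons_val', Matrix.cons_val_fin_one, smul_mul_assoc, mul_smul_comm,
        smul_sub, smul_smul]
      congr 2
      · field_simp
      · field_simp
    · induction l using Fin.lastCases with
      | last =>
        simp only [Fin.val_last, Nat.sub_self, lowerA_planeCoeff_zero_right q (n + 1),
          Pi.zero_apply, smul_zero, Fin.snoc_last]
      | cast l =>
        have h := lowerA_planeCoeff q l (n - l)
        have e : ((l : ℕ) + (n - l + 1)) = n + 1 := by omega
        have e' : n + 1 - (l : ℕ) = n - l + 1 := by omega
        have hs := csqrt_qnum_succ_ne_zero q (n - l)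
        rw [e] at h
        rw [Fin.snoc_castSucc, T_eq_planeCoeff, Fin.val_castSucc, e', h, Pi.smul_apply,
          qint_natCast, ← csqrt_qnum_mul_self, sqrtFact, smul_smul, smul_smul]
        rw [Fin.val_castSucc, e', sqrtFact] at hl'
        congr 1
        field_simp

end ClebschGordan

/-! ### Isometries and covariant matrices -/

section Covariance

open scoped Kronecker

/-! ### Kronecker products of isometries over a noncommutative ring -/

section Kronecker

variable {R : Type} [Ring R] [StarRing R] {ι κ ι' κ' : Type}

/-- The adjoint reverses products, so the entries of M*M appear between those of N* and N. Once they
are replaced by 0 or 1, N*N remains; no commutation between entries is needed. -/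
theorem kronecker_isometry [Fintype ι] [Fintype ι'] [DecidableEq κ] [DecidableEq κ']
    {M : Matrix ι κ R} {N : Matrix ι' κ' R} (hM : Mᴴ * M = 1) (hN : Nᴴ * N = 1) :
    (M ⊗ₖ N)ᴴ * (M ⊗ₖ N) = 1 := by
  ext ⟨b, l⟩ ⟨c, m⟩
  have h : ((M ⊗ₖ N)ᴴ * (M ⊗ₖ N)) (b, l) (c, m) =
      ∑ j, star (N j l) * (Mᴴ * M) b c * N j m := by
    simp only [Matrix.mul_apply, Matrix.conjTranspose_apply, Matrix.kroneckerMap_apply, star_mul,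
      Fintype.sum_prod_type, Finset.mul_sum, Finset.sum_mul, mul_assoc]
    exact Finset.sum_comm
  have h' : (Nᴴ * N) l m = ∑ j, star (N j l) * N j m := rfl
  rw [h, hM, Matrix.one_apply, Matrix.one_apply]
  by_cases hb : b = c
  · rw [if_pos hb]
    simp only [mul_one]
    rw [← h', hN, Matrix.one_apply]
    simp [hb]
  · simp [hb]

theorem kronecker_coisometry [Fintype κ] [Fintype κ'] [DecidableEq ι] [DecidableEq ι']
    {M : Matrix ι κ R} {N : Matrix ι' κ' R} (hM : M * Mᴴ = 1) (hN : N * Nᴴ = 1) :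
    (M ⊗ₖ N) * (M ⊗ₖ N)ᴴ = 1 := by
  ext ⟨b, l⟩ ⟨c, m⟩
  have h : ((M ⊗ₖ N) * (M ⊗ₖ N)ᴴ) (b, l) (c, m) =
      ∑ j, M b j * (N * Nᴴ) l m * star (M c j) := by
    simp only [Matrix.mul_apply, Matrix.conjTranspose_apply, Matrix.kroneckerMap_apply, star_mul,
      Fintype.sum_prod_type, Finset.mul_sum, Finset.sum_mul, mul_assoc]
  have h' : (M * Mᴴ) b c = ∑ j, M b j * star (M c j) := rfl
  rw [h, hN, Matrix.one_apply, Matrix.one_apply]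
  by_cases hl : l = m
  · rw [if_pos hl]
    simp only [mul_one]
    rw [← h', hM, Matrix.one_apply]
    simp [hl]
  · simp [hl]

end Kronecker

variable (q : Set.Ioo (0 : ℝ) 1)

/-! ### Coisometry of the corepresentation matrices -/

theorem T_zero : T q 0 = 1 := by
  ext k j
  fin_cases k
  fin_cases j
  simp [T, csqrt, qbinom]

/-- The corepresentation matrices `T⁽ⁿ⁾` are coisometric. -/
theorem T_coisometry : ∀ n : ℕ, T q n * (T q n)ᴴ = 1
  | 0 => by rw [T_zero, Matrix.conjTranspose_one, mul_one]
  | 1 => by rw [T_one, fundamental_right]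
  | n + 2 => by
    set M := fundamental q ⊗ₖ T q (n + 1)
    set C := scalarMat (OSU q) (raiseCG q (n + 1))
    set D := scalarMat (OSU q) (lowerCG q n)
    have hM : M * Mᴴ = 1 := kronecker_coisometry (fundamental_right q) (T_coisometry (n + 1))
    have hC : M * C = C * T q (n + 2) := kronecker_T_mul_raiseCG q (n + 1)
    have hD : M * D = D * T q n := kronecker_T_mul_lowerCG q n
    have hCC : Cᴴ * C = 1 := by
      rw [scalarMat_conjTranspose, ← scalarMat_mul, raiseCG_isometry, scalarMat_one]
    have hCD : Cᴴ * D = 0 := by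
      have h := congrArg Matrix.conjTranspose (lowerCG_raiseCG q n)
      rw [Matrix.conjTranspose_mul, Matrix.conjTranspose_conjTranspose,
        Matrix.conjTranspose_zero] at h
      rw [scalarMat_conjTranspose, ← scalarMat_mul, h]
      exact Matrix.map_zero _ (map_zero _)
    have h1 : C * Cᴴ + D * Dᴴ = 1 := by
      rw [scalarMat_conjTranspose, ← scalarMat_mul, scalarMat_conjTranspose, ← scalarMat_mul,
        ← scalarMat_one, ← raiseCG_add_lowerCG]
      exact (Matrix.map_add _ (map_add _) _ _).symm
    -- Adjoint form of the intertwining relation, obtained without any unitarity of T: insert CC* +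
    -- DD* = 1, and the second part dies because M D = D T⁽ⁿ⁾ and C*D = 0.
    have h2 : Cᴴ * M = T q (n + 2) * Cᴴ := by
      calc Cᴴ * M = Cᴴ * M * (C * Cᴴ + D * Dᴴ) := by rw [h1, Matrix.mul_one]
        _ = Cᴴ * (M * C) * Cᴴ + Cᴴ * (M * D) * Dᴴ := by
          simp only [Matrix.mul_add, Matrix.mul_assoc]
        _ = Cᴴ * C * T q (n + 2) * Cᴴ + Cᴴ * D * T q n * Dᴴ := by
          rw [hC, hD, Matrix.mul_assoc Cᴴ C, Matrix.mul_assoc Cᴴ D]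
        _ = T q (n + 2) * Cᴴ := by
          rw [hCC, hCD, Matrix.one_mul, Matrix.zero_mul, Matrix.zero_mul, add_zero]
    have h3 : T q (n + 2) = Cᴴ * M * C := by
      rw [h2, Matrix.mul_assoc, hCC, Matrix.mul_one]
    calc T q (n + 2) * (T q (n + 2))ᴴ
        = T q (n + 2) * (Cᴴ * M * C)ᴴ := by rw [← h3]
      _ = (T q (n + 2) * Cᴴ) * (Mᴴ * C) := by
        rw [Matrix.conjTranspose_mul, Matrix.conjTranspose_mul, Matrix.conjTranspose_conjTranspose,
          Matrix.mul_assoc]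
      _ = Cᴴ * (M * Mᴴ) * C := by rw [← h2]; simp only [Matrix.mul_assoc]
      _ = 1 := by rw [hM, Matrix.mul_one, hCC]

/-! ### Covariant matrices and coinvariant products -/

variable {q}

/-- The rows of the matrix `M` over `O(S^7_q)` transform according to the matrix `t` under the
coaction. -/
def IsCovariant {ι κ : Type} [Fintype κ] (M : Matrix ι κ (OS7 q)) (t : Matrix κ κ (OSU q)) : Prop :=
  ∀ i k, coaction q (M i k) = ∑ j, M i j ⊗ₜ[ℂ] t j k

namespace IsCovariant

variable {ι ι' κ κ' : Type} [Fintype κ] [Fintype κ'] {M : Matrix ι κ (OS7 q)}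
  {N : Matrix ι' κ' (OS7 q)} {t : Matrix κ κ (OSU q)} {s : Matrix κ' κ' (OSU q)}

theorem kronecker (hM : IsCovariant M t) (hN : IsCovariant N s) :
    IsCovariant (M ⊗ₖ N) (t ⊗ₖ s) := by
  rintro ⟨i, i'⟩ ⟨k, k'⟩
  simp only [Matrix.kroneckerMap_apply, map_mul, hM i k, hN i' k', Finset.sum_mul_sum,
    Algebra.TensorProduct.tmul_mul_tmul, Fintype.sum_prod_type]

theorem mul_scalarMat (hM : IsCovariant M t) {C : Matrix κ κ' ℂ}
    (h : t * scalarMat (OSU q) C = scalarMat (OSU q) C * s) :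
    IsCovariant (M * scalarMat (OS7 q) C) s := by
  intro i k
  have h1 : coaction q ((M * scalarMat (OS7 q) C) i k) =
      ∑ j, M i j ⊗ₜ[ℂ] (t * scalarMat (OSU q) C) j k := by
    simp only [mul_scalarMat_apply, map_sum, map_smul, hM i _, TensorProduct.tmul_sum,
      Finset.smul_sum, TensorProduct.tmul_smul]
    exact Finset.sum_comm
  rw [h1, h]
  simp only [mul_scalarMat_apply, scalarMat_mul_apply, TensorProduct.tmul_sum,
    TensorProduct.sum_tmul, TensorProduct.tmul_smul, ← TensorProduct.smul_tmul']
  exact Finset.sum_comm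

theorem submatrix (hM : IsCovariant M t) (e : ι' → ι) : IsCovariant (M.submatrix e id) t :=
  fun i k => hM (e i) k

/-- The coaction produces t t* in the second tensor factor, and this is the identity. -/
theorem mul_conjTranspose_mem [DecidableEq κ] {N : Matrix ι' κ (OS7 q)} (hM : IsCovariant M t)
    (hN : IsCovariant N t) (ht : t * tᴴ = 1) (i : ι) (i' : ι') : (M * Nᴴ) i i' ∈ OS4 q := by
  change coaction q _ = _
  have h : coaction q ((M * Nᴴ) i i') =
      ∑ j, ∑ l, (M i j * star (N i' l)) ⊗ₜ[ℂ] (t * tᴴ) j l := by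
    simp only [Matrix.mul_apply, Matrix.conjTranspose_apply, map_sum, map_mul, map_star, hM i _,
      hN i' _, star_sum, TensorProduct.star_tmul, Finset.sum_mul_sum,
      Algebra.TensorProduct.tmul_mul_tmul, TensorProduct.tmul_sum]
    rw [Finset.sum_comm]
    exact Finset.sum_congr rfl fun _ _ => Finset.sum_comm
  rw [h, ht]
  simp only [Matrix.one_apply, TensorProduct.tmul_ite, TensorProduct.tmul_zero, Finset.sum_ite_eq,
    Finset.mem_univ, if_true, Matrix.mul_apply, Matrix.conjTranspose_apply, TensorProduct.sum_tmul]

end IsCovariant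

variable (q)

/-! ### The matrices `U⁽ⁿ⁾` and `W⁽ⁿ⁾` -/

theorem u_isometry : (u q)ᴴ * u q = 1 := by
  have hq := qc_ne_zero q
  have b1 := congrArg star (x_s12 q)
  have b2 := congrArg star (x_s13 q)
  have b3 := congrArg star (x_s14 q)
  have b4 := congrArg star (x_s23 q)
  have b5 := congrArg star (x_s24 q)
  have b6 := congrArg star (x_s34 q)
  -- The two sphere relations eliminate x₄x₄* and x₄*x₄. The other relations and their adjoints
  -- bring the remaining words to a common order.
  have c1 := eq_sub_of_add_eq' (x_sphere q)
  have c2 := eq_sub_of_add_eq' (x_sphere' q)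
  simp only [x_s11, x_s22, x_s33] at c2
  simp only [star_mul, star_smul, star_add, star_sub, star_star, star_qc, star_pow, star_inv₀]
    at b1 b2 b3 b4 b5 b6
  ext i j
  rw [Matrix.mul_apply, Fin.sum_univ_four]
  fin_cases i <;> fin_cases j <;>
  simp [u, star_qc] <;>
  simp only [x_x12, x_x13, x_x14, x_x23, x_x24, x_x34, x_s11, x_s12, x_s13, x_s14, x_s22, x_s23,
    x_s24, x_s33, x_s34, b1, b2, b3, b4, b5, b6, c1, c2, smul_add, smul_sub, smul_smul] <;>
  match_scalars <;> (try field_simp) <;> ring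

/-- A multi-index, as a pair consisting of its first entry and of the remaining entries. -/
abbrev splitIndex (n : ℕ) : (Fin (n + 1) → Fin 4) ≃ Fin 4 × (Fin n → Fin 4) :=
  (Fin.consEquiv fun _ => Fin 4).symm

/-- The recursion in matrix form; the padded columns of the definition come from the vanishing
entries of `raiseCG`. -/
theorem U_succ (n : ℕ) : U q (n + 1) =
    ((u q ⊗ₖ U q n) * scalarMat (OS7 q) (raiseCG q n)).submatrix (splitIndex n) id := by
  ext I k
  rw [Matrix.submatrix_apply, mul_scalarMat_apply, id, sum_raiseCG_col, U]
  refine congrArg _ (congrArg₂ _ (congrArg _ ?_) (congrArg _ ?_))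
  · induction k using Fin.lastCases with
    | last => simp [bullet]
    | cast k => simp [bullet, col]
  · induction k using Fin.cases with
    | zero => simp [bullet]
    | succ k => simp [bullet, col]

theorem W_eq (n : ℕ) : W q n =
    ((u q ⊗ₖ U q (n + 1)) * scalarMat (OS7 q) (lowerCG q n)).submatrix (splitIndex (n + 1)) id := by
  ext I k
  rw [Matrix.submatrix_apply, mul_scalarMat_apply, id, sum_lowerCG_col, W]
  rfl

theorem conjTranspose_submatrix_mul {R ι ι' κ κ' : Type} [Ring R] [StarRing R] [Fintype ι]
    [Fintype ι'] (e : ι' ≃ ι) (M : Matrix ι κ R) (N : Matrix ι κ' R) :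
    (M.submatrix e id)ᴴ * N.submatrix e id = Mᴴ * N := by
  rw [Matrix.conjTranspose_submatrix, Matrix.submatrix_mul_equiv, Matrix.submatrix_id_id]

theorem conjTranspose_mul_scalarMat {R ι κ μ μ' : Type} [Ring R] [Algebra ℂ R] [StarRing R]
    [StarModule ℂ R] [Fintype ι] [Fintype κ] [DecidableEq κ] {M : Matrix ι κ R} (hM : Mᴴ * M = 1)
    (C : Matrix κ μ ℂ) (D : Matrix κ μ' ℂ) :
    (M * scalarMat R C)ᴴ * (M * scalarMat R D) = scalarMat R (Cᴴ * D) := by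
  rw [Matrix.conjTranspose_mul, Matrix.mul_assoc, ← Matrix.mul_assoc Mᴴ, hM, Matrix.one_mul,
    scalarMat_conjTranspose, scalarMat_mul]

theorem U_isometry (n : ℕ) : (U q n)ᴴ * U q n = 1 := by
  induction n with
  | zero =>
    ext k j
    fin_cases k
    fin_cases j
    simp only [Matrix.mul_apply, Matrix.conjTranspose_apply]
    simp [U]
  | succ n ih =>
    rw [U_succ, conjTranspose_submatrix_mul,
      conjTranspose_mul_scalarMat (kronecker_isometry (u_isometry q) ih), raiseCG_isometry,
      scalarMat_one]

theorem W_isometry (n : ℕ) : (W q n)ᴴ * W q n = 1 := by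
  rw [W_eq, conjTranspose_submatrix_mul,
    conjTranspose_mul_scalarMat (kronecker_isometry (u_isometry q) (U_isometry q (n + 1))),
    lowerCG_isometry, scalarMat_one]

theorem W_orthogonal_U (n : ℕ) : (W q n)ᴴ * U q (n + 2) = 0 := by
  rw [W_eq, U_succ q (n + 1), conjTranspose_submatrix_mul,
    conjTranspose_mul_scalarMat (kronecker_isometry (u_isometry q) (U_isometry q (n + 1))),
    lowerCG_raiseCG]
  exact Matrix.map_zero _ (map_zero _)

theorem U_isCovariant (n : ℕ) : IsCovariant (U q n) (T q n) := by
  induction n with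
  | zero =>
    intro I k
    fin_cases k
    rw [T_zero, Fin.sum_univ_one]
    exact map_one (coaction q)
  | succ n ih =>
    rw [U_succ]
    exact ((IsCovariant.kronecker (coaction_u q) ih).mul_scalarMat
      (kronecker_T_mul_raiseCG q n)).submatrix _

theorem W_isCovariant (n : ℕ) : IsCovariant (W q n) (T q n) := by
  rw [W_eq]
  exact ((IsCovariant.kronecker (coaction_u q) (U_isCovariant q (n + 1))).mul_scalarMat
    (kronecker_T_mul_lowerCG q n)).submatrix _

end Covariance

/-! ### The cotensor product in coordinates -/

section Coordinates

variable (q : Set.Ioo (0 : ℝ) 1) {κ : Type} [Fintype κ] [DecidableEq κ]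

/-- The coordinates of an element of `O(S^7_q) ⊗ ℂ^κ`. -/
def coords : OS7 q ⊗[ℂ] (κ → ℂ) ≃ₗ[ℂ] (κ → OS7 q) :=
  TensorProduct.piScalarRight ℂ ℂ (OS7 q) κ

theorem coords_tmul (a : OS7 q) (v : κ → ℂ) (k : κ) : coords q (a ⊗ₜ v) k = v k • a := rfl

theorem coords_op_smul (b : (OS4 q)ᵐᵒᵖ) (z : OS7 q ⊗[ℂ] (κ → ℂ)) (k : κ) :
    coords q (b • z) k = coords q z k * (b.unop : OS7 q) := by
  induction z using TensorProduct.induction_on with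
  | zero => simp
  | add y z hy hz => rw [smul_add, map_add, Pi.add_apply, hy, hz, map_add, Pi.add_apply, add_mul]
  | tmul a v =>
    rw [TensorProduct.smul_tmul', coords_tmul, coords_tmul, smul_mul_assoc]
    rfl

/-- The coordinates of an element of `O(S^7_q) ⊗ (O(SU_q(2)) ⊗ ℂ^κ)`. -/
def coactCoords : OS7 q ⊗[ℂ] (OSU q ⊗[ℂ] (κ → ℂ)) ≃ₗ[ℂ] (κ → OS7 q ⊗[ℂ] OSU q) :=
  (TensorProduct.assoc ℂ (OS7 q) (OSU q) (κ → ℂ)).symm ≪≫ₗ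
    TensorProduct.piScalarRight ℂ ℂ (OS7 q ⊗[ℂ] OSU q) κ

theorem coactCoords_tmul (a : OS7 q) (h : OSU q) (v : κ → ℂ) (k : κ) :
    coactCoords q (a ⊗ₜ (h ⊗ₜ v)) k = v k • (a ⊗ₜ h) := rfl

theorem coactCoords_coactLeft (z : OS7 q ⊗[ℂ] (κ → ℂ)) (k : κ) :
    coactCoords q (coactLeft q z) k = coaction q (coords q z k) := by
  induction z using TensorProduct.induction_on with
  | zero => simp
  | add y z hy hz => simp only [map_add, Pi.add_apply, hy, hz]
  | tmul a v =>
    rw [coords_tmul, map_smul]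
    have h : coactLeft q (a ⊗ₜ v) =
        TensorProduct.assoc ℂ (OS7 q) (OSU q) (κ → ℂ) (coaction q a ⊗ₜ v) := rfl
    rw [h, coactCoords, LinearEquiv.trans_apply, LinearEquiv.symm_apply_apply]
    rfl

theorem leftCoaction_apply (n : ℕ) (v : Fin (n + 1) → ℂ) :
    leftCoaction q n v = ∑ i, v i • ∑ j, T q n i j ⊗ₜ[ℂ] Pi.single j (1 : ℂ) := by
  rw [leftCoaction, Module.Basis.constr_apply_fintype]
  rfl

theorem coactCoords_coactRight (n : ℕ) (z : OS7 q ⊗[ℂ] (Fin (n + 1) → ℂ)) (k : Fin (n + 1)) :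
    coactCoords q (coactRight q (leftCoaction q n) z) k = ∑ j, coords q z j ⊗ₜ[ℂ] T q n j k := by
  induction z using TensorProduct.induction_on with
  | zero => simp
  | add y z hy hz =>
    simp only [map_add, Pi.add_apply, hy, hz, TensorProduct.add_tmul, Finset.sum_add_distrib]
  | tmul a v =>
    rw [coactRight, LinearMap.lTensor_tmul, leftCoaction_apply]
    simp only [TensorProduct.tmul_sum, TensorProduct.tmul_smul, map_sum, map_smul,
      Finset.sum_apply, Pi.smul_apply, coactCoords_tmul, coords_tmul, Pi.single_apply, ite_smul,
      one_smul, zero_smul, Finset.sum_ite_eq, Finset.mem_univ, if_true,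
      ← TensorProduct.smul_tmul']

/-- Comparing coefficients of the basis vectors of V_n shows that ℰ_n consists of the rows that are
covariant for T⁽ⁿ⁾. -/
theorem mem_E_iff (n : ℕ) (z : OS7 q ⊗[ℂ] (Fin (n + 1) → ℂ)) :
    z ∈ E q n ↔ ∀ k, coaction q (coords q z k) = ∑ j, coords q z j ⊗ₜ[ℂ] T q n j k := by
  change coactLeft q z = coactRight q (leftCoaction q n) z ↔ _
  rw [← (coactCoords q).injective.eq_iff, funext_iff]
  simp only [coactCoords_coactLeft, coactCoords_coactRight]

end Coordinates

/-! ### Coinvariant matrices -/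

section Coinvariant

variable (q : Set.Ioo (0 : ℝ) 1)

/-- Identities over O(S⁴_q) can be checked over O(S⁷_q), where the factors U and W have their
entries. -/
theorem map_coe_injective {ι κ : Type} :
    Function.Injective fun M : Matrix ι κ (OS4 q) => M.map fun b => (b : OS7 q) :=
  Matrix.map_injective Subtype.val_injective

theorem map_coe_mul {ι κ μ : Type} [Fintype κ] (M : Matrix ι κ (OS4 q)) (N : Matrix κ μ (OS4 q)) :
    (M * N).map (fun b => (b : OS7 q)) =
      M.map (fun b => (b : OS7 q)) * N.map fun b => (b : OS7 q) :=
  Matrix.map_mul (f := ((OS4 q).subtype : OS4 q →+* OS7 q))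

theorem map_coe_conjTranspose {ι κ : Type} (M : Matrix ι κ (OS4 q)) :
    Mᴴ.map (fun b => (b : OS7 q)) = (M.map fun b => (b : OS7 q))ᴴ := rfl

variable {q}

/-- The matrix `M N^*` of coinvariant elements obtained from two matrices whose rows transform
according to the same coisometric matrix. -/
def IsCovariant.mulConjTranspose {ι ι' κ : Type} [Fintype κ] [DecidableEq κ]
    {M : Matrix ι κ (OS7 q)} {N : Matrix ι' κ (OS7 q)} {t : Matrix κ κ (OSU q)}
    (hM : IsCovariant M t) (hN : IsCovariant N t) (ht : t * tᴴ = 1) : Matrix ι ι' (OS4 q) :=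
  fun i i' => ⟨(M * Nᴴ) i i', hM.mul_conjTranspose_mem hN ht i i'⟩

theorem IsCovariant.map_mulConjTranspose {ι ι' κ : Type} [Fintype κ] [DecidableEq κ]
    {M : Matrix ι κ (OS7 q)} {N : Matrix ι' κ (OS7 q)} {t : Matrix κ κ (OSU q)}
    (hM : IsCovariant M t) (hN : IsCovariant N t) (ht : t * tᴴ = 1) :
    (hM.mulConjTranspose hN ht).map (fun b => (b : OS7 q)) = M * Nᴴ := rfl

/-- Left multiplication of a row by coinvariant elements. -/
theorem IsCovariant.coinvariant_mul {ι ι' κ : Type} [Fintype κ] [Fintype ι]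
    {M : Matrix ι κ (OS7 q)} {t : Matrix κ κ (OSU q)} (hM : IsCovariant M t)
    (b : Matrix ι' ι (OS4 q)) : IsCovariant (b.map (fun b => (b : OS7 q)) * M) t := by
  intro i k
  have hb : ∀ j, coaction q (b i j : OS7 q) = (b i j : OS7 q) ⊗ₜ 1 := fun j => (b i j).2
  simp only [Matrix.mul_apply, Matrix.map_apply, map_sum, map_mul, hb, hM _ k, Finset.mul_sum,
    Algebra.TensorProduct.tmul_mul_tmul, one_mul, TensorProduct.sum_tmul]
  exact Finset.sum_comm

/-! ### The cotensor product as the range of a projection -/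

variable (q)

/-- The coordinates of `z` in the dual basis, making the conjugate of `T⁽ⁿ⁾` act. -/
def dualCoords (n : ℕ) : OS7 q ⊗[ℂ] (Fin (n + 1) → ℂ) →ₗ[ℂ] (Fin (n + 1) → OS7 q) where
  toFun z k := (-qc q) ^ (k : ℕ) • coords q z k.rev
  map_add' y z := by
    ext k
    simp only [map_add, Pi.add_apply, smul_add]
  map_smul' c z := by
    ext k
    simp only [map_smul, Pi.smul_apply, RingHom.id_apply, smul_comm c]

theorem dualCoords_apply (n : ℕ) (z : OS7 q ⊗[ℂ] (Fin (n + 1) → ℂ)) (k : Fin (n + 1)) :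
    dualCoords q n z k = (-qc q) ^ (k : ℕ) • coords q z k.rev := rfl

theorem dualCoords_bijective (n : ℕ) : Function.Bijective (dualCoords q n) := by
  have hq : -qc q ≠ 0 := neg_ne_zero.2 (qc_ne_zero q)
  refine ⟨fun y z h => (coords q).injective (funext fun k => ?_), fun a => ?_⟩
  · have h1 := congrFun h k.rev
    rw [dualCoords_apply, dualCoords_apply, Fin.rev_rev] at h1
    exact smul_right_injective _ (pow_ne_zero _ hq) h1
  · refine ⟨(coords q).symm fun k => ((-qc q) ^ (k.rev : ℕ))⁻¹ • a k.rev, funext fun k => ?_⟩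
    rw [dualCoords_apply, LinearEquiv.apply_symm_apply, Fin.rev_rev, smul_smul,
      mul_inv_cancel₀ (pow_ne_zero _ hq), one_smul]

/-- For M y to be coinvariant, the column y must transform by the adjoint of T⁽ⁿ⁾, whereas the
coordinates of ℰ_n transform by T⁽ⁿ⁾ itself. The equivalence of T⁽ⁿ⁾ with its conjugate converts one
condition into the other. -/
theorem mem_E_iff_dualCoords (n : ℕ) (z : OS7 q ⊗[ℂ] (Fin (n + 1) → ℂ)) :
    z ∈ E q n ↔ IsCovariant (fun (_ : Unit) k => star (dualCoords q n z k)) (T q n) := by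
  have hq : -qc q ≠ 0 := neg_ne_zero.2 (qc_ne_zero q)
  have key : ∀ k : Fin (n + 1),
      coaction q (star (dualCoords q n z k)) =
          ∑ j, star (dualCoords q n z j) ⊗ₜ[ℂ] T q n j k ↔
        coaction q (coords q z k.rev) = ∑ j, coords q z j ⊗ₜ[ℂ] T q n j k.rev := by
    intro k
    -- After taking adjoints and reversing the summation index, the power (-q)^j in `dualCoords`
    -- cancels the inverse power in `star_T`. The common factor (-q)^k is then removed.
    rw [← star_injective.eq_iff, ← map_star, star_star, dualCoords_apply, map_smul, star_sum,
      ← Equiv.sum_comp Fin.revPerm fun j => coords q z j ⊗ₜ[ℂ] T q n j k.rev,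
      ← (smul_right_injective _ (pow_ne_zero (k : ℕ) hq)).eq_iff (a := coaction q _)]
    refine Eq.congr_right (Eq.trans (Finset.sum_congr rfl fun j _ => ?_) Finset.smul_sum.symm)
    rw [TensorProduct.star_tmul, star_star, star_T, dualCoords_apply, TensorProduct.tmul_smul,
      ← TensorProduct.smul_tmul', smul_smul, Fin.revPerm_apply, mul_assoc,
      inv_mul_cancel₀ (pow_ne_zero _ hq), mul_one]
  rw [mem_E_iff]
  constructor
  · rintro h ⟨⟩ k
    exact (key k).2 (h k.rev)
  · intro h k
    have := (key k.rev).1 (h () k.rev)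
    rwa [Fin.rev_rev] at this

theorem dualCoords_op_smul (n : ℕ) (b : (OS4 q)ᵐᵒᵖ) (z : OS7 q ⊗[ℂ] (Fin (n + 1) → ℂ))
    (k : Fin (n + 1)) : dualCoords q n (b • z) k = dualCoords q n z k * (b.unop : OS7 q) := by
  rw [dualCoords_apply, dualCoords_apply, coords_op_smul, smul_mul_assoc]

/-- The map `ℰ_n → O(S^4_q)^ι` attached to a matrix whose rows transform according to `T⁽ⁿ⁾`. -/
def cotensorToPi {ι : Type} (n : ℕ) {M : Matrix ι (Fin (n + 1)) (OS7 q)}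
    (hM : IsCovariant M (T q n)) : E q n →ₗ[(OS4 q)ᵐᵒᵖ] (ι → OS4 q) where
  toFun z i := ⟨(M *ᵥ dualCoords q n z) i, by
    have h := hM.mul_conjTranspose_mem ((mem_E_iff_dualCoords q n z).1 z.2) (T_coisometry q n) i ()
    -- The column is written as N* for the one-row covariant matrix N formed by the adjoints of the
    -- dual coordinates.
    have e : (M *ᵥ dualCoords q n z) i =
        (M * (fun (_ : Unit) k => star (dualCoords q n z k) : Matrix Unit _ _)ᴴ) i () := by
      simp only [Matrix.mul_apply, Matrix.conjTranspose, Matrix.map_apply, Matrix.transpose_apply,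
        Matrix.mulVec, dotProduct]
      exact Finset.sum_congr rfl fun k _ =>
        congrArg (M i k * ·) (star_star (dualCoords q n z k)).symm
    rwa [e]⟩
  map_add' y z := by
    ext i
    simp [Matrix.mulVec_add]
  map_smul' b z := by
    ext i
    simp only [Submodule.coe_smul, Matrix.mulVec, dotProduct, dualCoords_op_smul, RingHom.id_apply,
      Pi.smul_apply, ← mul_assoc, ← Finset.sum_mul]
    rfl

theorem cotensorToPi_injective {ι : Type} [Fintype ι] (n : ℕ)
    {M : Matrix ι (Fin (n + 1)) (OS7 q)} (hM : IsCovariant M (T q n)) (h : Mᴴ * M = 1) :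
    Function.Injective (cotensorToPi q n hM) := by
  intro y z hyz
  have h1 : M *ᵥ dualCoords q n y = M *ᵥ dualCoords q n z :=
    funext fun i => congrArg Subtype.val (congrFun hyz i)
  have h2 := congrArg (Mᴴ *ᵥ ·) h1
  simp only [Matrix.mulVec_mulVec, h, Matrix.one_mulVec] at h2
  exact Subtype.ext ((dualCoords_bijective q n).1 h2)

theorem range_cotensorToPi {ι : Type} [Fintype ι] (n : ℕ)
    {M : Matrix ι (Fin (n + 1)) (OS7 q)} (hM : IsCovariant M (T q n)) (h : Mᴴ * M = 1) :
    LinearMap.range (cotensorToPi q n hM) =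
      rangeModule (hM.mulConjTranspose hM (T_coisometry q n)) := by
  have hv : ∀ (v : ι → OS4 q) (i : ι),
      (((hM.mulConjTranspose hM (T_coisometry q n)) *ᵥ v) i : OS7 q) =
        (M *ᵥ (Mᴴ *ᵥ fun j => (v j : OS7 q))) i := by
    intro v i
    rw [Matrix.mulVec_mulVec]
    exact map_sum ((OS4 q).subtype : OS4 q →+* OS7 q) _ _
  ext v
  constructor
  · rintro ⟨z, rfl⟩
    -- An element M y is fixed by M M*, since M*M = 1.
    refine ⟨cotensorToPi q n hM z, funext fun i => Subtype.ext ((hv _ i).trans ?_)⟩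
    change (M *ᵥ (Mᴴ *ᵥ (M *ᵥ dualCoords q n z))) i = (M *ᵥ dualCoords q n z) i
    rw [Matrix.mulVec_mulVec (dualCoords q n z), h, Matrix.one_mulVec]
  · rintro ⟨w, rfl⟩
    -- The preimage of M M* w has dual coordinates M* w. It lies in ℰ_n because (M* w)* = w* M is a
    -- coinvariant row times a covariant matrix.
    obtain ⟨z, hz⟩ := (dualCoords_bijective q n).2 (Mᴴ *ᵥ fun j => (w j : OS7 q))
    have hz' : z ∈ E q n := by
      rw [mem_E_iff_dualCoords, hz]
      have h1 := hM.coinvariant_mul fun (_ : Unit) j => star (w j)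
      refine (congrArg (IsCovariant · _) (funext₂ fun _ k => ?_)).mp h1
      simp [Matrix.mul_apply, Matrix.mulVec, dotProduct]
      rfl
    refine ⟨⟨z, hz'⟩, funext fun i => Subtype.ext (Eq.trans ?_ (hv w i).symm)⟩
    change (M *ᵥ dualCoords q n z) i = _
    rw [hz]

end Coinvariant

end QuantumSphere

end

theorem proposition5p7 (q : Set.Ioo (0 : ℝ) 1) (n : ℕ) :
    (W q n)ᴴ * W q n = 1 ∧
    (W q n)ᴴ * U q (n + 2) = 0 ∧
    (∀ (I : Fin (n + 2) → Fin 4) (k : Fin (n + 1)),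
      coaction q (W q n I k) = ∑ j : Fin (n + 1), W q n I j ⊗ₜ[ℂ] T q n j k) ∧
    ∃ (P : Matrix (Fin n → Fin 4) (Fin n → Fin 4) (OS4 q))
      (Q : Matrix (Fin (n + 2) → Fin 4) (Fin (n + 2) → Fin 4) (OS4 q)),
      P.map (fun b => (b : OS7 q)) = U q n * (U q n)ᴴ ∧
      Q.map (fun b => (b : OS7 q)) = W q n * (W q n)ᴴ ∧
      IsStarProjection Q ∧
      Nonempty (rangeModule Q ≃ₗ[(OS4 q)ᵐᵒᵖ] E q n) ∧
      ∃ V : Matrix (Fin n → Fin 4) (Fin (n + 2) → Fin 4) (OS4 q),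
        V * Vᴴ = P ∧ Vᴴ * V = Q := by
  have hU := U_isCovariant q n
  have hW := W_isCovariant q n
  have hT := T_coisometry q n
  have hUU := U_isometry q n
  have hWW := W_isometry q n
  -- The partial isometry is V = U W*: in V V* the inner factor W*W collapses to 1, and in V*V the
  -- factor U*U does.
  refine ⟨hWW, W_orthogonal_U q n, hW, hU.mulConjTranspose hU hT, hW.mulConjTranspose hW hT,
    rfl, rfl, ⟨?_, ?_⟩, ?_, hU.mulConjTranspose hW hT, ?_, ?_⟩
  · apply map_coe_injective q
    simp only [map_coe_mul, IsCovariant.map_mulConjTranspose]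
    rw [Matrix.mul_assoc, ← Matrix.mul_assoc _ (W q n), hWW, Matrix.one_mul]
  · apply map_coe_injective q
    change (_ᴴ : Matrix _ _ (OS4 q)).map _ = _
    rw [map_coe_conjTranspose, IsCovariant.map_mulConjTranspose, Matrix.conjTranspose_mul,
      Matrix.conjTranspose_conjTranspose]
    rfl
  · exact ⟨((LinearEquiv.ofInjective _ (cotensorToPi_injective q n hW hWW)).trans
      (LinearEquiv.ofEq _ _ (range_cotensorToPi q n hW hWW))).symm⟩
  · apply map_coe_injective q
    simp only [map_coe_mul, map_coe_conjTranspose, IsCovariant.map_mulConjTranspose]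
    rw [Matrix.conjTranspose_mul, Matrix.conjTranspose_conjTranspose, Matrix.mul_assoc,
      ← Matrix.mul_assoc _ (W q n), hWW, Matrix.one_mul]
  · apply map_coe_injective q
    simp only [map_coe_mul, map_coe_conjTranspose, IsCovariant.map_mulConjTranspose]
    rw [Matrix.conjTranspose_mul, Matrix.conjTranspose_conjTranspose, Matrix.mul_assoc,
      ← Matrix.mul_assoc _ (U q n), hUU, Matrix.one_mul]
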